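/- Let $X\subseteq\mathbb{R}^n$ be closed and convex, $(\Xi,\mathcal G)$ a measurable space, $T:\Xi\times\mathbb{R}^n\to\mathbb{R}^n$ measurable, and $\xi:\Omega\to\Xi$ a random variable on a probability space $(\Omega,\mathcal F,\mathbb P)$. Put $H(x)=\mathbb E[T(\xi,x)]$, let $P_X$ be the Euclidean projection onto $X$, let $r_t(x)=\|P_X(x-tH(x))-x\|$, and let $\mathrm{SOL}(X,H)$ be the set of solutions of $\mathrm{SVI}(X,H)$, i.e. of all $x^*\in X$ with $\langle H(x^*),x-x^*\rangle\ge 0$ for all $x\in X$. Assume $\mathrm{SOL}(X,H)\neq\emptyset$ and: 1. $H$ is pseudomonotone on $X$: for all $x,y\in X$, $\langle H(x),y-x\rangle\ge0$ implies $\langle H(y),y-x\rangle\ge0$. 2. There are a measurable $L:\Xi\to\mathbb{R}$ and $p\ge2$ such that $L(\xi)\ge1$ almost surely, for almost every $s\in\Xi$ with respect to the law of $\xi$ one has $\|T(s,x)-T(s,y)\|\le L(s)\|x-y\|$ for all $x,y\in\mathbb{R}^n$, and $\mathbb E[L(\xi)^{2p}]<\infty$; and there are $\check x\in\mathbb{R}^n$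 and $q\ge2$ with $\mathbb E[\|T(\xi,\check x)\|^{2q}]<\infty$. 3. $S_0,S_1,\ldots$ are positive integers with $\sum_{k\ge0}1/\sqrt{S_k}<\infty$; the samples $\xi^k_j,\eta^k_j$ ($k\ge0$, $1\le j\le S_k$) are jointly independent, each distributed as $\xi$; and the (possibly random) starting point $x_0$ takes values in $X$ and is independent of all samples. Write $H_{\xi^k}(x)=\frac1{S_k}\sum_{j=1}^{S_k}T(\xi^k_j,x)$ and $H_{\eta^k}(x)=\frac1{S_k}\sum_{j=1}^{S_k}T(\eta^k_j,x)$. The Anderson(1)-SEG algorithm with parameters $\nu\ge0$, $\gamma\in(0,1]$, $\rho\in(0,1)$, $\mu\in(0,\frac{\sqrt3}3)$, $\tau>\frac12$, $M>0$ starts from $x_0$ and $\theta_0=1$ and, for $k=0,1,2,\ldots$, proceeds as follows. - If $P_X(x_k-\gamma H_{\xi^k}(x_k))=x_k$, set $x_{k+1}=x_k$, $\theta_{k+1}=\theta_k$. Otherwise: - (line search) let $t_k$ be the first $t$ among $\gamma,\gamma\rho,\gamma\rho^2,\ldots$ for which $y=P_X(x_k-tH_{\xi^k}(x_k))$ satisfies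 $t\|H_{\xi^k}(x_k)-H_{\xi^k}(y)\|\le\mu\|x_k-y\|$, and put $y_{k+0.5}=P_X(x_k-t_kH_{\xi^k}(x_k))$, $y_{k+1}=P_X(x_k-t_kH_{\eta^k}(y_{k+0.5}))$, $F_k=y_{k+0.5}-x_k$, $\tilde F_k=y_{k+1}-x_k$. - If $\|\tilde F_k\|<\min\{\|F_k\|,\nu\theta_k^{-\tau}\}$, set $\alpha_k=\langle\tilde F_k,\tilde F_k-F_k\rangle/\|\tilde F_k-F_k\|^2$; otherwise set $\alpha_k=M+1$. - If $|\alpha_k|\le M$, set $x_{k+1}=\alpha_kx_k+(1-\alpha_k)y_{k+1}$, $\theta_{k+1}=\theta_k+1$; otherwise set $x_{k+1}=y_{k+1}$, $\theta_{k+1}=\theta_k$. Then, almost surely, every line search that is performed terminates (so that the sequence $\{x_k\}$ is well defined), $\{x_k\}$ converges to a (possibly random) element of $\mathrm{SOL}(X,H)$, and $r_\gamma(x_k)\to0$. -/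

import Mathlib

open Filter Topology MeasureTheory ProbabilityTheory

namespace AndersonSEG

noncomputable section

/-- `ℝⁿ` with the Euclidean norm. -/
abbrev Vec (n : ℕ) : Type := EuclideanSpace ℝ (Fin n)

/-- The Euclidean projection `P_X(x) = argmin_{y ∈ X} ‖y - x‖`
(a unique point when `X` is nonempty, closed and convex). -/
def proj {n : ℕ} (X : Set (Vec n)) (x : Vec n) : Vec n :=
  Classical.epsilon fun y => y ∈ X ∧ ∀ z ∈ X, ‖y - x‖ ≤ ‖z - x‖

/-- `P_X(x - t h(x))`. -/
def projStep {n : ℕ} (X : Set (Vec n)) (h : Vec n → Vec n) (t : ℝ) (x : Vec n) : Vec n :=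
  proj X (x - t • h x)

/-- The residual function `r_t(x) = ‖P_X(x - t H(x)) - x‖`. -/
def residual {n : ℕ} (X : Set (Vec n)) (H : Vec n → Vec n) (t : ℝ) (x : Vec n) : ℝ :=
  ‖projStep X H t x - x‖

/-- The mean operator `H(x) = 𝔼[T(ξ, x)]`. -/
def meanOp {n : ℕ} {Ω Ξ : Type*} [MeasurableSpace Ω] (P : Measure Ω)
    (T : Ξ → Vec n → Vec n) (ξ : Ω → Ξ) (x : Vec n) : Vec n :=
  ∫ ω, T (ξ ω) x ∂P

/-- The solution set of the variational inequality `VI(X, H)`. -/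
def SOL {n : ℕ} (X : Set (Vec n)) (H : Vec n → Vec n) : Set (Vec n) :=
  {x | x ∈ X ∧ ∀ y ∈ X, 0 ≤ inner ℝ (H x) (y - x)}

/-- `H` is pseudomonotone on `X`. -/
def PseudomonotoneOn {n : ℕ} (H : Vec n → Vec n) (X : Set (Vec n)) : Prop :=
  ∀ x ∈ X, ∀ y ∈ X, 0 ≤ inner ℝ (H x) (y - x) → 0 ≤ inner ℝ (H y) (y - x)

/-- The Lipschitz and moment conditions on the random operator `T(ξ, ·)`; `P.map ξ` is the law
of `ξ`, so the Lipschitz bound is required for almost every realization `s` of `ξ`. -/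
structure LipschitzMoment {n : ℕ} {Ω Ξ : Type*} [MeasurableSpace Ω] [MeasurableSpace Ξ]
    (P : Measure Ω) (T : Ξ → Vec n → Vec n) (ξ : Ω → Ξ) : Prop where
  lipschitz : ∃ L : Ξ → ℝ, Measurable L ∧ (∀ᵐ ω ∂P, 1 ≤ L (ξ ω)) ∧
    (∀ᵐ s ∂(P.map ξ), ∀ x y : Vec n, ‖T s x - T s y‖ ≤ L s * ‖x - y‖) ∧
    ∃ p : ℝ, 2 ≤ p ∧ Integrable (fun ω => L (ξ ω) ^ (2 * p)) P
  moment : ∃ (z : Vec n) (q : ℝ), 2 ≤ q ∧ Integrable (fun ω => ‖T (ξ ω) z‖ ^ (2 * q)) P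

/-- The empirical estimator `x ↦ (1/N) ∑ⱼ T(sⱼ, x)` of `H` for a sample `s` of size `N`. -/
def empMean {n : ℕ} {Ξ : Type*} {N : ℕ} (T : Ξ → Vec n → Vec n) (s : Fin N → Ξ)
    (x : Vec n) : Vec n :=
  (N : ℝ)⁻¹ • ∑ j, T (s j) x

/-- The numerical parameters of the algorithm. -/
structure Params where
  ν : ℝ
  γ : ℝ
  ρ : ℝ
  μ : ℝ
  τ : ℝ
  M : ℝ

/-- The admissible ranges of the parameters. -/
structure Params.Admissible (a : Params) : Prop where
  ν_nonneg : 0 ≤ a.ν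
  γ_pos : 0 < a.γ
  γ_le_one : a.γ ≤ 1
  ρ_pos : 0 < a.ρ
  ρ_lt_one : a.ρ < 1
  μ_pos : 0 < a.μ
  μ_lt : a.μ < √3 / 3
  τ_gt : 1 / 2 < a.τ
  M_pos : 0 < a.M

/-- The state `(x_k, θ_k)` of the algorithm. -/
structure State (n : ℕ) where
  x : Vec n
  θ : ℕ

/-- The line search at `x`, run with the estimator `h = H_{ξ^k}`, accepts the trial
stepsize `t`: with `y = P_X(x - t h(x))` one has `t ‖h(x) - h(y)‖ ≤ μ ‖x - y‖`. -/
def Accepts {n : ℕ} (a : Params) (X : Set (Vec n)) (h : Vec n → Vec n) (x : Vec n)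
    (t : ℝ) : Prop :=
  t * ‖h x - h (projStep X h t x)‖ ≤ a.μ * ‖x - projStep X h t x‖

/-- The stepsize returned by the line search: the first of `γ, γρ, γρ², …` that is accepted.
(If none is, the value is `γ`; this convention is irrelevant whenever the search terminates.) -/
def stepsize {n : ℕ} (a : Params) (X : Set (Vec n)) (h : Vec n → Vec n) (x : Vec n) : ℝ :=
  a.γ * a.ρ ^ sInf {m : ℕ | Accepts a X h x (a.γ * a.ρ ^ m)}

open scoped Classical in
/-- One iteration of Anderson(1)-SEG, with `hξ = H_{ξ^k}` and `hη = H_{η^k}`. -/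
def step {n : ℕ} (a : Params) (X : Set (Vec n)) (hξ hη : Vec n → Vec n) (s : State n) :
    State n :=
  if projStep X hξ a.γ s.x - s.x = 0 then s
  else
    let t := stepsize a X hξ s.x
    let yHalf := projStep X hξ t s.x
    let F := yHalf - s.x
    let y := proj X (s.x - t • hη yHalf)
    let F' := y - s.x
    let α : ℝ :=
      if ‖F'‖ < min ‖F‖ (a.ν * (s.θ : ℝ) ^ (-a.τ)) then
        inner ℝ F' (F' - F) / ‖F' - F‖ ^ 2
      else a.M + 1
    if |α| ≤ a.M then ⟨α • s.x + (1 - α) • y, s.θ + 1⟩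
    else ⟨y, s.θ⟩

/-- The states generated by Anderson(1)-SEG from the starting point `x₀`, where `u k` and `v k`
are the realizations of the two samples of size `S k` used in iteration `k`. -/
def state {n : ℕ} {Ξ : Type*} (a : Params) (X : Set (Vec n)) (T : Ξ → Vec n → Vec n)
    {S : ℕ → ℕ} (u v : (k : ℕ) → Fin (S k) → Ξ) (x₀ : Vec n) : ℕ → State n
  | 0 => ⟨x₀, 1⟩
  | k + 1 => step a X (empMean T (u k)) (empMean T (v k)) (state a X T u v x₀ k)

/-- The iterates `x_k`. -/
def iterate {n : ℕ} {Ξ : Type*} (a : Params) (X : Set (Vec n)) (T : Ξ → Vec n → Vec n)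
    {S : ℕ → ℕ} (u v : (k : ℕ) → Fin (S k) → Ξ) (x₀ : Vec n) (k : ℕ) : Vec n :=
  (state a X T u v x₀ k).x

/-- The random variables `ξs k j`, `ηs k j` (`j < S k`, `k = 0, 1, …`) are jointly independent
copies of `ξ`, and they are independent of the starting point `x₀`. -/
structure IIDSamples {n : ℕ} {Ω Ξ : Type*} [MeasurableSpace Ω] [MeasurableSpace Ξ]
    (P : Measure Ω) (ξ : Ω → Ξ) (x₀ : Ω → Vec n) {S : ℕ → ℕ}
    (ξs ηs : (k : ℕ) → Fin (S k) → Ω → Ξ) : Prop where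
  measurable_ξs : ∀ k j, Measurable (ξs k j)
  measurable_ηs : ∀ k j, Measurable (ηs k j)
  identDistrib_ξs : ∀ k j, IdentDistrib (ξs k j) ξ P P
  identDistrib_ηs : ∀ k j, IdentDistrib (ηs k j) ξ P P
  indep : iIndepFun
    (Sum.elim (fun i : (k : ℕ) × Fin (S k) => ξs i.1 i.2)
      (fun i : (k : ℕ) × Fin (S k) => ηs i.1 i.2)) P
  indep_init : IndepFun x₀
    (fun ω => ((fun k j => ξs k j ω, fun k j => ηs k j ω) :
      ((k : ℕ) → Fin (S k) → Ξ) × ((k : ℕ) → Fin (S k) → Ξ))) P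

end

end AndersonSEG

/-! The proof separates a deterministic convergence statement from a probabilistic estimate of the
sampling errors.

Pathwise part. Pseudomonotonicity and the line search test give a Fejér inequality towards every
solution for the extragradient point, up to sampling errors at the trial point y. `step_fejer`
extends it to the Anderson step. The coefficient is below 1/2, so at least half of the decrease
survives. The price is at most M(1+M)(νθ^(-τ))², which is summable because θ increases at each
accelerated step and 2τ > 1. When the errors, relative to 1 + ‖x_k‖, are summable,
`quasiFejer_tendsto` makes the distance to every solution converge and ‖y - x_k‖ vanish. A uniform
Lipschitz constant for the estimators bounds the stepsizes below, so the residual vanishes. A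
cluster point is then a solution, and its own distance sequence must tend to 0
(`tendsto_of_summable_errors`).

Probabilistic part. At a point independent of the sample, the mean error is O(1/√S_k) relative to
the size of the point, hence almost surely summable in k. This covers x_k with the first sample and
y with the second. The difficulty is the error of the first sample at y, since y and the stepsize
are built from that sample. `correlated_error_le` replaces y by P_X(x_k - tH(x_k)) with the same t,
at the cost of a multiple of the error at x_k. As t lies on the grid γρ^m, only countably many
points occur, all determined by x_k. They approach P_X(x_k) geometrically, and the mean error
increment is proportional to the distance between points. Summing the increments therefore controls
all grid points at once with the rate 1/√S_k (`SecondMoments.exists_lintegral_relTrialError_le`). -/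

namespace AndersonSEG

/-! ### Euclidean projection and natural residual -/

section Projection

variable {n : ℕ} {X : Set (Vec n)}

theorem proj_spec (hX : IsClosed X) (hne : X.Nonempty) (x : Vec n) :
    proj X x ∈ X ∧ ∀ z ∈ X, ‖proj X x - x‖ ≤ ‖z - x‖ := by
  refine Classical.epsilon_spec (p := fun y => y ∈ X ∧ ∀ z ∈ X, ‖y - x‖ ≤ ‖z - x‖) ?_
  obtain ⟨y, hy, hxy⟩ := hX.exists_infDist_eq_dist hne x
  refine ⟨y, hy, fun z hz => ?_⟩
  rw [← dist_eq_norm, ← dist_eq_norm, dist_comm y, ← hxy, dist_comm z]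
  exact Metric.infDist_le_dist_of_mem hz

theorem proj_mem (hX : IsClosed X) (hne : X.Nonempty) (x : Vec n) : proj X x ∈ X :=
  (proj_spec hX hne x).1

theorem inner_proj_le_zero (hX : IsClosed X) (hc : Convex ℝ X) (x : Vec n) {z : Vec n}
    (hz : z ∈ X) : inner ℝ (x - proj X x) (z - proj X x) ≤ 0 := by
  obtain ⟨h1, h2⟩ := proj_spec hX ⟨z, hz⟩ x
  have : Nonempty X := ⟨⟨z, hz⟩⟩
  refine (norm_eq_iInf_iff_real_inner_le_zero hc h1).1 (le_antisymm ?_ ?_) z hz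
  · refine le_ciInf fun w => ?_
    rw [norm_sub_rev x, norm_sub_rev x]
    exact h2 w w.2
  · exact ciInf_le ⟨0, by rintro _ ⟨w, rfl⟩; positivity⟩ (⟨_, h1⟩ : X)

/-- Adding the two obtuse-angle inequalities gives firm nonexpansiveness; Cauchy–Schwarz finishes.
-/
theorem norm_proj_sub_proj_le (hX : IsClosed X) (hc : Convex ℝ X) (hne : X.Nonempty)
    (x y : Vec n) : ‖proj X x - proj X y‖ ≤ ‖x - y‖ := by
  have h1 := inner_proj_le_zero hX hc x (proj_mem hX hne y)
  have h2 := inner_proj_le_zero hX hc y (proj_mem hX hne x)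
  have h3 : ‖proj X x - proj X y‖ ^ 2 ≤ inner ℝ (x - y) (proj X x - proj X y) := by
    rw [← real_inner_self_eq_norm_sq]
    simp only [inner_sub_left, inner_sub_right] at *
    rw [real_inner_comm (proj X x) (proj X y)] at *
    linarith
  have h4 := real_inner_le_norm (x - y) (proj X x - proj X y)
  by_contra! h
  nlinarith [norm_nonneg (x - y)]

theorem continuous_proj (hX : IsClosed X) (hc : Convex ℝ X) (hne : X.Nonempty) :
    Continuous (proj X) := by
  refine (LipschitzWith.of_dist_le_mul (K := 1) fun x y => ?_).continuous
  simpa [dist_eq_norm] using norm_proj_sub_proj_le hX hc hne x y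

theorem proj_eq_self (hX : IsClosed X) {x : Vec n} (hx : x ∈ X) : proj X x = x := by
  have := (proj_spec hX ⟨x, hx⟩ x).2 x hx
  simpa [sub_eq_zero] using this

/-- The residual `t ↦ ‖P_X(x - t h(x)) - x‖` is monotone and sublinear in `t`. -/
theorem residual_le_and_mul_le (hX : IsClosed X) (hc : Convex ℝ X) (hne : X.Nonempty)
    (h : Vec n → Vec n) {s t : ℝ} (ht : 0 < t) (hts : t ≤ s) (x : Vec n) :
    residual X h t x ≤ residual X h s x ∧ t * residual X h s x ≤ s * residual X h t x := by
  have h1 := inner_proj_le_zero hX hc (x - t • h x) (proj_mem hX hne (x - s • h x))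
  have h2 := inner_proj_le_zero hX hc (x - s • h x) (proj_mem hX hne (x - t • h x))
  simp only [residual, projStep]
  set p := proj X (x - t • h x)
  set q := proj X (x - s • h x)
  -- Weighting `h1` by `s` and `h2` by `t` cancels the terms containing `h x`.
  have key : s * ‖p - x‖ ^ 2 + t * ‖q - x‖ ^ 2 ≤ (s + t) * inner ℝ (p - x) (q - x) := by
    have e1 : x - t • h x - p = -(p - x) - t • h x := by abel
    have e2 : x - s • h x - q = -(q - x) - s • h x := by abel
    have e3 : q - p = (q - x) - (p - x) := by abel
    have e4 : p - q = (p - x) - (q - x) := by abel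
    rw [e1, e3] at h1
    rw [e2, e4] at h2
    generalize p - x = a at *
    generalize q - x = b at *
    simp only [inner_sub_left, inner_sub_right, inner_neg_left, inner_smul_left,
      real_inner_self_eq_norm_sq, RCLike.conj_to_real] at h1 h2
    rw [real_inner_comm a b] at *
    have h1' := mul_le_mul_of_nonneg_left h1 (ht.le.trans hts)
    have h2' := mul_le_mul_of_nonneg_left h2 ht.le
    nlinarith
  have h5 := real_inner_le_norm (p - x) (q - x)
  -- Cauchy–Schwarz turns `key` into a factored quadratic; since `t ≤ s`, its sign yields both
  -- claims.
  have h6 : (s * ‖p - x‖ - t * ‖q - x‖) * (‖p - x‖ - ‖q - x‖) ≤ 0 := by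
    have := mul_le_mul_of_nonneg_left h5 (by linarith : 0 ≤ s + t)
    nlinarith
  have ha := norm_nonneg (p - x)
  have hb := norm_nonneg (q - x)
  generalize ‖p - x‖ = u at *
  generalize ‖q - x‖ = v at *
  constructor
  · by_contra! hlt
    have : 0 < s * u - t * v := by nlinarith
    nlinarith
  · by_contra! hlt
    have : 0 < v - u := by
      by_contra! h'
      nlinarith
    nlinarith

theorem mem_SOL_of_residual_eq_zero (hX : IsClosed X) (hc : Convex ℝ X) (hne : X.Nonempty)
    {H : Vec n → Vec n} {t : ℝ} (ht : 0 < t) {x : Vec n} (h : residual X H t x = 0) :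
    x ∈ SOL X H := by
  have hx : proj X (x - t • H x) = x := by
    simpa [residual, projStep, sub_eq_zero] using h
  refine ⟨hx ▸ proj_mem hX hne _, fun y hy => ?_⟩
  have := inner_proj_le_zero hX hc (x - t • H x) hy
  rw [hx, sub_sub_cancel_left, inner_neg_left, inner_smul_left] at this
  simp only [RCLike.conj_to_real] at this
  nlinarith

theorem continuous_residual (hX : IsClosed X) (hc : Convex ℝ X) (hne : X.Nonempty)
    {H : Vec n → Vec n} (hH : Continuous H) (t : ℝ) : Continuous (residual X H t) := by
  have := continuous_proj hX hc hne
  unfold residual projStep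
  fun_prop

theorem norm_projStep_sub_projStep_le (hX : IsClosed X) (hc : Convex ℝ X) (hne : X.Nonempty)
    (h h' : Vec n → Vec n) {t : ℝ} (ht : 0 ≤ t) (x : Vec n) :
    ‖projStep X h t x - projStep X h' t x‖ ≤ t * ‖h x - h' x‖ := by
  refine (norm_proj_sub_proj_le hX hc hne _ _).trans ?_
  rw [sub_sub_sub_cancel_left, ← smul_sub, norm_smul, Real.norm_of_nonneg ht, norm_sub_rev]

end Projection

/-! ### Termination of the line search and lower bound on the stepsize -/

section Stepsize

variable {n : ℕ} {X : Set (Vec n)} {a : Params} {h : Vec n → Vec n} {Λ : ℝ}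

theorem accepts_of_mul_le (hh : ∀ x y, ‖h x - h y‖ ≤ Λ * ‖x - y‖) {t : ℝ} (ht : 0 ≤ t)
    (htΛ : t * Λ ≤ a.μ) (x : Vec n) : Accepts a X h x t := by
  unfold Accepts
  calc _ ≤ t * (Λ * ‖x - projStep X h t x‖) := by gcongr; exact hh _ _
    _ = t * Λ * ‖x - projStep X h t x‖ := by ring
    _ ≤ _ := by gcongr

theorem exists_accepts (ha : a.Admissible) (hh : ∀ x y, ‖h x - h y‖ ≤ Λ * ‖x - y‖)
    (x : Vec n) : ∃ m : ℕ, Accepts a X h x (a.γ * a.ρ ^ m) := by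
  have h1 : Tendsto (fun m : ℕ => a.γ * a.ρ ^ m * Λ) atTop (𝓝 (a.γ * 0 * Λ)) :=
    ((tendsto_pow_atTop_nhds_zero_of_lt_one ha.ρ_pos.le ha.ρ_lt_one).const_mul _).mul_const _
  rw [mul_zero, zero_mul] at h1
  obtain ⟨m, hm⟩ := (h1.eventually (gt_mem_nhds ha.μ_pos)).exists
  exact ⟨m, accepts_of_mul_le hh
    (mul_nonneg ha.γ_pos.le (pow_nonneg ha.ρ_pos.le _)) hm.le x⟩

theorem accepts_stepsize (ha : a.Admissible) (hh : ∀ x y, ‖h x - h y‖ ≤ Λ * ‖x - y‖)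
    (x : Vec n) : Accepts a X h x (stepsize a X h x) :=
  Nat.sInf_mem (s := {m : ℕ | Accepts a X h x (a.γ * a.ρ ^ m)}) (exists_accepts ha hh x)

theorem stepsize_pos (ha : a.Admissible) (x : Vec n) : 0 < stepsize a X h x :=
  mul_pos ha.γ_pos (pow_pos ha.ρ_pos _)

theorem stepsize_le (ha : a.Admissible) (x : Vec n) : stepsize a X h x ≤ a.γ :=
  mul_le_of_le_one_right ha.γ_pos.le (pow_le_one₀ ha.ρ_pos.le ha.ρ_lt_one.le)

/-- If the search stops at exponent m+1, the trial γρ^m was rejected, which forces γρ^m Λ > μ; one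
more factor ρ gives the bound. -/
theorem min_le_stepsize (ha : a.Admissible) (hΛ : 0 < Λ)
    (hh : ∀ x y, ‖h x - h y‖ ≤ Λ * ‖x - y‖) (x : Vec n) :
    min a.γ (a.ρ * a.μ / Λ) ≤ stepsize a X h x := by
  unfold stepsize
  rcases hm : sInf {m : ℕ | Accepts a X h x (a.γ * a.ρ ^ m)} with _ | m
  · simp
  · refine (min_le_right _ _).trans ?_
    have hnot : m ∉ {m : ℕ | Accepts a X h x (a.γ * a.ρ ^ m)} :=
      Nat.notMem_of_lt_sInf (by omega)
    have h1 : a.μ < a.γ * a.ρ ^ m * Λ := by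
      by_contra! hle
      exact hnot (accepts_of_mul_le hh
        (mul_nonneg ha.γ_pos.le (pow_nonneg ha.ρ_pos.le _)) hle x)
    rw [div_le_iff₀ hΛ, pow_succ]
    nlinarith [ha.ρ_pos]

end Stepsize

/-! ### Fejér inequality for one iteration -/

section OneStep

variable {n : ℕ} {X : Set (Vec n)} {a : Params} {H hξ hη : Vec n → Vec n}

/-- The Fejér-type inequality for one projected extragradient step. -/
theorem extragradient_fejer (hX : IsClosed X) (hc : Convex ℝ X) (hp : PseudomonotoneOn H X)
    {t μ : ℝ} (ht : 0 ≤ t) (ht1 : t ≤ 1) {x xs : Vec n} (hxs : xs ∈ SOL X H)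
    (hacc : t * ‖hξ x - hξ (projStep X hξ t x)‖ ≤ μ * ‖x - projStep X hξ t x‖) :
    ‖proj X (x - t • hη (projStep X hξ t x)) - xs‖ ^ 2 ≤ ‖x - xs‖ ^ 2
      - (1 - 3 * μ ^ 2) * ‖projStep X hξ t x - x‖ ^ 2
      + (3 * ‖hξ (projStep X hξ t x) - H (projStep X hξ t x)‖ ^ 2
        + 3 * ‖hη (projStep X hξ t x) - H (projStep X hξ t x)‖ ^ 2
        + 2 * ‖hη (projStep X hξ t x) - H (projStep X hξ t x)‖
          * ‖projStep X hξ t x - xs‖) := by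
  have hne : X.Nonempty := ⟨xs, hxs.1⟩
  have hyX : projStep X hξ t x ∈ X := proj_mem hX hne _
  have hzX : proj X (x - t • hη (projStep X hξ t x)) ∈ X := proj_mem hX hne _
  have h1 := inner_proj_le_zero hX hc (x - t • hη (projStep X hξ t x)) hxs.1
  have h2 : inner ℝ (x - t • hξ x - projStep X hξ t x)
    (proj X (x - t • hη (projStep X hξ t x)) - projStep X hξ t x) ≤ 0 :=
    inner_proj_le_zero hX hc (x - t • hξ x) hzX
  have h3 := hp xs hxs.1 _ hyX (hxs.2 _ hyX)
  set y := projStep X hξ t x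
  set z := proj X (x - t • hη y)
  have h4 : -inner ℝ (hη y - H y) (y - xs) ≤ ‖hη y - H y‖ * ‖y - xs‖ := by
    rw [← inner_neg_left, ← norm_neg (hη y - H y)]
    exact real_inner_le_norm _ _
  have h5 : inner ℝ (hξ x - hη y) (z - y) ≤ ‖hξ x - hη y‖ * ‖z - y‖ := real_inner_le_norm _ _
  have h6 : ‖hξ x - hη y‖ ≤ ‖hξ x - hξ y‖ + ‖hξ y - H y‖ + ‖hη y - H y‖ := by
    calc ‖hξ x - hη y‖ = ‖(hξ x - hξ y) + (hξ y - H y) - (hη y - H y)‖ := by congr 1; abel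
      _ ≤ _ := (norm_sub_le _ _).trans (by gcongr; exact norm_add_le _ _)
  have h7 : t * ‖hξ x - hη y‖ ≤ μ * ‖y - x‖ + ‖hξ y - H y‖ + ‖hη y - H y‖ := by
    rw [norm_sub_rev y x]
    have hB := norm_nonneg (hξ y - H y)
    have hC := norm_nonneg (hη y - H y)
    calc t * ‖hξ x - hη y‖ ≤ t * (‖hξ x - hξ y‖ + ‖hξ y - H y‖ + ‖hη y - H y‖) := by gcongr
      _ ≤ _ := by nlinarith
  -- expand all squares around `y`
  have hz : ‖z - xs‖ ^ 2 = ‖x - xs‖ ^ 2 - ‖y - x‖ ^ 2 - ‖z - y‖ ^ 2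
      + 2 * inner ℝ (x - t • hη y - z) (xs - z) + 2 * inner ℝ (x - t • hξ x - y) (z - y)
      + 2 * (t * inner ℝ (hξ x - hη y) (z - y)) - 2 * t * inner ℝ (hη y) (y - xs) := by
    have e1 : x - xs = (x - y) + (y - xs) := by abel
    have e2 : z - xs = (z - y) + (y - xs) := by abel
    have e3 : x - t • hη y - z = (x - y) - (z - y) - t • hη y := by abel
    have e4 : xs - z = -(z - y) - (y - xs) := by abel
    have e5 : x - t • hξ x - y = (x - y) - t • hξ x := by abel
    rw [e1, e2, e3, e4, e5, norm_sub_rev y x]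
    generalize x - y = p
    generalize z - y = q
    generalize y - xs = r
    rw [norm_add_sq_real, norm_add_sq_real]
    simp only [inner_sub_left, inner_sub_right, inner_neg_right, inner_smul_left,
      real_inner_self_eq_norm_sq, RCLike.conj_to_real]
    ring
  have h8 : inner ℝ (hη y) (y - xs) = inner ℝ (H y) (y - xs) + inner ℝ (hη y - H y) (y - xs) := by
    rw [inner_sub_left]; ring
  have hB := norm_nonneg (hξ y - H y)
  have hC := norm_nonneg (hη y - H y)
  have h9 : t * inner ℝ (hξ x - hη y) (z - y)
      ≤ (μ * ‖y - x‖ + ‖hξ y - H y‖ + ‖hη y - H y‖) * ‖z - y‖ := by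
    calc t * inner ℝ (hξ x - hη y) (z - y) ≤ t * (‖hξ x - hη y‖ * ‖z - y‖) := by gcongr
      _ = t * ‖hξ x - hη y‖ * ‖z - y‖ := by ring
      _ ≤ _ := by gcongr
  have h10 : -(2 * t * inner ℝ (hη y) (y - xs)) ≤ 2 * ‖hη y - H y‖ * ‖y - xs‖ := by
    rw [h8]
    have : 0 ≤ ‖hη y - H y‖ * ‖y - xs‖ := by positivity
    nlinarith [mul_nonneg ht h3, mul_le_mul_of_nonneg_left h4 ht]
  generalize ‖hξ y - H y‖ = B at *
  generalize ‖hη y - H y‖ = C at *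
  -- With S = μ‖y - x‖ + B + C, use 2S‖z - y‖ - ‖z - y‖² ≤ S² ≤ 3(μ²‖y - x‖² + B² + C²). This is the
  -- origin of the condition μ < √3/3.
  nlinarith [sq_nonneg (μ * ‖y - x‖ + B + C - ‖z - y‖), sq_nonneg (μ * ‖y - x‖ - B),
    sq_nonneg (μ * ‖y - x‖ - C), sq_nonneg (B - C)]

/-- The Anderson coefficient is smaller than `1 / 2` when the second residual is shorter. -/
theorem anderson_coeff_lt {F G : Vec n} (h : ‖G‖ < ‖F‖) :
    inner ℝ G (G - F) / ‖G - F‖ ^ 2 < 1 / 2 := by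
  have hne : G - F ≠ 0 := by
    intro h0
    rw [sub_eq_zero] at h0
    exact absurd h (by simp [h0])
  have hpos : 0 < ‖G - F‖ ^ 2 := by positivity
  rw [div_lt_iff₀ hpos, norm_sub_sq_real, inner_sub_right, real_inner_self_eq_norm_sq]
  nlinarith [norm_nonneg G]

/-- The increment of `∑ (ν θ^{-τ})²` over the accelerated iterations. -/
noncomputable def accelWeight (a : Params) (s s' : State n) : ℝ :=
  if s'.θ = s.θ + 1 then (a.ν * (s.θ : ℝ) ^ (-a.τ)) ^ 2 else 0

theorem accelWeight_nonneg (s s' : State n) : 0 ≤ accelWeight a s s' := by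
  unfold accelWeight
  split_ifs <;> positivity

theorem step_theta (s : State n) :
    (step a X hξ hη s).θ = s.θ ∨ (step a X hξ hη s).θ = s.θ + 1 := by
  unfold step
  split_ifs
  · exact Or.inl rfl
  · dsimp only
    split_ifs <;> simp

theorem Params.Admissible.one_sub_pos (ha : a.Admissible) : 0 < (1 - 3 * a.μ ^ 2) / 2 := by
  have h1 := ha.μ_lt
  have h2 : a.μ ^ 2 < (√3 / 3) ^ 2 := by gcongr; exact ha.μ_pos.le
  rw [div_pow, Real.sq_sqrt (by norm_num)] at h2
  linarith

/-- For an affine combination, the squared distance to `xs` is the same combination of squared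
distances minus α(1-α)‖z - x‖². Since -M ≤ α < 1/2, the weight 1-α lies between 1/2 and 1+M, and the
last term costs at most M(1+M)‖z - x‖², with ‖z - x‖ < νθ^(-τ) by the acceptance test. -/
theorem step_fejer (hX : IsClosed X) (hc : Convex ℝ X) (hp : PseudomonotoneOn H X)
    (ha : a.Admissible) {Λ : ℝ} (hh : ∀ x y, ‖hξ x - hξ y‖ ≤ Λ * ‖x - y‖)
    {xs : Vec n} (hxs : xs ∈ SOL X H) (s : State n) {y : Vec n}
    (hy : y = projStep X hξ (stepsize a X hξ s.x) s.x) :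
    ‖(step a X hξ hη s).x - xs‖ ^ 2 ≤ ‖s.x - xs‖ ^ 2
      - (1 - 3 * a.μ ^ 2) / 2 * ‖y - s.x‖ ^ 2
      + (1 + a.M) * (3 * ‖hξ y - H y‖ ^ 2 + 3 * ‖hη y - H y‖ ^ 2
        + 2 * ‖hη y - H y‖ * ‖y - xs‖)
      + a.M * (1 + a.M) * accelWeight a s (step a X hξ hη s) := by
  have hM := ha.M_pos
  have hμ3 : 3 * a.μ ^ 2 < 1 := by linarith [ha.one_sub_pos]
  by_cases h0 : projStep X hξ a.γ s.x - s.x = 0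
  · have hstep : step a X hξ hη s = s := by simp [step, h0]
    -- Monotonicity of the residual in the stepsize: if it vanishes at γ, it vanishes at the smaller
    -- step, so y = x.
    have hr := (residual_le_and_mul_le hX hc ⟨xs, hxs.1⟩ hξ (stepsize_pos ha s.x)
      (stepsize_le (X := X) (h := hξ) ha s.x) s.x).1
    have hy0 : ‖y - s.x‖ = 0 := by
      refine le_antisymm ?_ (norm_nonneg _)
      rw [hy]
      simpa [residual, h0] using hr
    have hw := accelWeight_nonneg (a := a) s s
    rw [hstep, hy0]
    have : 0 ≤ a.M * (1 + a.M) * accelWeight a s s := by positivity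
    have : 0 ≤ (1 + a.M) * (3 * ‖hξ y - H y‖ ^ 2 + 3 * ‖hη y - H y‖ ^ 2
        + 2 * ‖hη y - H y‖ * ‖y - xs‖) := by positivity
    linarith
  · have hex := extragradient_fejer (hη := hη) hX hc hp (stepsize_pos ha s.x).le
      ((stepsize_le (X := X) (h := hξ) ha s.x).trans ha.γ_le_one) hxs
      (accepts_stepsize ha hh s.x)
    rw [← hy] at hex
    have hw := accelWeight_nonneg (a := a) s (step a X hξ hη s)
    have hE : 0 ≤ 3 * ‖hξ y - H y‖ ^ 2 + 3 * ‖hη y - H y‖ ^ 2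
        + 2 * ‖hη y - H y‖ * ‖y - xs‖ := by positivity
    generalize 3 * ‖hξ y - H y‖ ^ 2 + 3 * ‖hη y - H y‖ ^ 2
        + 2 * ‖hη y - H y‖ * ‖y - xs‖ = E at *
    unfold step at hw ⊢
    rw [if_neg h0] at hw ⊢
    dsimp only at hw ⊢
    rw [← hy] at hw ⊢
    set z := proj X (s.x - stepsize a X hξ s.x • hη y)
    have hF := sq_nonneg ‖y - s.x‖
    by_cases hcond : ‖z - s.x‖ < min ‖y - s.x‖ (a.ν * (s.θ : ℝ) ^ (-a.τ))
    · rw [if_pos hcond] at hw ⊢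
      obtain ⟨hc1, hc2⟩ := lt_min_iff.1 hcond
      have hα := anderson_coeff_lt hc1
      set α : ℝ := inner ℝ (z - s.x) (z - s.x - (y - s.x)) / ‖z - s.x - (y - s.x)‖ ^ 2
      split_ifs with hαM
      · have hα' := abs_le.1 hαM
        simp only [accelWeight, if_true]
        have hid : ‖α • s.x + (1 - α) • z - xs‖ ^ 2 = α * ‖s.x - xs‖ ^ 2
            + (1 - α) * ‖z - xs‖ ^ 2 - α * (1 - α) * ‖z - s.x‖ ^ 2 := by
          have e1 : α • s.x + (1 - α) • z - xs = α • (s.x - xs) + (1 - α) • (z - xs) := by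
            module
          have e2 : z - s.x = (z - xs) - (s.x - xs) := by abel
          rw [e1, e2]
          generalize s.x - xs = p
          generalize z - xs = q
          rw [norm_add_sq_real, norm_sub_sq_real, inner_smul_left, inner_smul_right,
            norm_smul, norm_smul, mul_pow, mul_pow, Real.norm_eq_abs, Real.norm_eq_abs, sq_abs,
            sq_abs, real_inner_comm q p]
          simp only [RCLike.conj_to_real]
          ring
        have hz2 : ‖z - s.x‖ ^ 2 ≤ (a.ν * (s.θ : ℝ) ^ (-a.τ)) ^ 2 := by gcongr
        rw [hid]
        generalize (a.ν * (s.θ : ℝ) ^ (-a.τ)) ^ 2 = w at *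
        have hz0 := sq_nonneg ‖z - s.x‖
        have i1 : -(α * (1 - α)) * ‖z - s.x‖ ^ 2 ≤ a.M * (1 + a.M) * w := by
          have : -(α * (1 - α)) ≤ a.M * (1 + a.M) := by nlinarith
          calc _ ≤ a.M * (1 + a.M) * ‖z - s.x‖ ^ 2 := by gcongr
            _ ≤ _ := by gcongr
        have i2 : (1 - α) * ‖z - xs‖ ^ 2 ≤ (1 - α) * (‖s.x - xs‖ ^ 2
            - (1 - 3 * a.μ ^ 2) * ‖y - s.x‖ ^ 2 + E) := by
          gcongr
          linarith
        have i3 : (1 - α) * E ≤ (1 + a.M) * E := by gcongr; linarith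
        have i4 : 1 / 2 * ((1 - 3 * a.μ ^ 2) * ‖y - s.x‖ ^ 2)
            ≤ (1 - α) * ((1 - 3 * a.μ ^ 2) * ‖y - s.x‖ ^ 2) := by
          have : 0 ≤ 1 - 3 * a.μ ^ 2 := by linarith
          gcongr
          linarith
        nlinarith
      · simp only [accelWeight]
        rw [if_neg (by omega)]
        nlinarith [mul_nonneg (sub_pos.2 hμ3).le hF]
    -- The default coefficient M+1 exceeds M, so the plain extragradient point is taken.
    · rw [if_neg hcond, if_neg (by rw [abs_of_pos (by linarith)]; linarith)]
      simp only [accelWeight]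
      rw [if_neg (by omega)]
      nlinarith [mul_nonneg (sub_pos.2 hμ3).le hF]

end OneStep

/-- A deterministic quasi-Fejér convergence lemma. -/
theorem quasiFejer_tendsto {V D δ : ℕ → ℝ} (hV : ∀ k, 0 ≤ V k) (hD : ∀ k, 0 ≤ D k)
    (hδ : ∀ k, 0 ≤ δ k) (hsum : Summable δ)
    (hrec : ∀ k, V (k + 1) ≤ V k + δ k * (1 + V k) - D k) :
    (∃ l, Tendsto V atTop (𝓝 l)) ∧ Tendsto D atTop (𝓝 0) := by
  -- Discrete Grönwall bound: it makes `V` bounded, so the multiplicative perturbation becomes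
  -- additive.
  have hexp : ∀ k, 1 + V k ≤ (1 + V 0) * Real.exp (∑ i ∈ Finset.range k, δ i) := by
    intro k
    induction k with
    | zero => simp
    | succ k ih =>
      rw [Finset.sum_range_succ, Real.exp_add]
      have h1 : 1 + V (k + 1) ≤ (1 + V k) * (1 + δ k) := by linarith [hrec k, hD k]
      have h2 : 1 + δ k ≤ Real.exp (δ k) := by linarith [Real.add_one_le_exp (δ k)]
      have h3 := hV k
      have h4 := hδ k
      have h5 := hV 0
      calc 1 + V (k + 1) ≤ (1 + V k) * (1 + δ k) := h1
        _ ≤ (1 + V 0) * Real.exp (∑ i ∈ Finset.range k, δ i) * Real.exp (δ k) := by gcongr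
        _ = _ := by ring
  set R := (1 + V 0) * Real.exp (∑' i, δ i)
  have hR : ∀ k, 1 + V k ≤ R := fun k => by
    have h0 := hV 0
    refine (hexp k).trans ?_
    exact mul_le_mul_of_nonneg_left (Real.exp_le_exp.2
      (hsum.sum_le_tsum (Finset.range k) fun i _ => hδ i)) (by linarith)
  have hsum' : Summable fun k => δ k * R := hsum.mul_right R
  have hrec' : ∀ k, V (k + 1) ≤ V k + δ k * R - D k := fun k => by
    have := mul_le_mul_of_nonneg_left (hR k) (hδ k)
    linarith [hrec k]
  -- Removing the accumulated perturbation leaves a monotone sequence, bounded below.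
  have hanti : Antitone fun k => V k - ∑ i ∈ Finset.range k, δ i * R := by
    refine antitone_nat_of_succ_le fun k => ?_
    rw [Finset.sum_range_succ]
    linarith [hrec' k, hD k]
  have hRpos : 0 ≤ R := by linarith [hR 0, hV 0]
  have hbdd : BddBelow (Set.range fun k => V k - ∑ i ∈ Finset.range k, δ i * R) := by
    refine ⟨-∑' i, δ i * R, ?_⟩
    rintro _ ⟨k, rfl⟩
    have := hsum'.sum_le_tsum (Finset.range k) fun i _ => mul_nonneg (hδ i) hRpos
    simp only
    linarith [hV k]
  have hlim := (tendsto_atTop_ciInf hanti hbdd).add hsum'.hasSum.tendsto_sum_nat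
  simp only [sub_add_cancel] at hlim
  refine ⟨⟨_, hlim⟩, ?_⟩
  have h1 := (hlim.sub (hlim.comp (tendsto_add_atTop_nat 1))).add hsum'.tendsto_atTop_zero
  rw [sub_self, zero_add] at h1
  exact squeeze_zero hD (fun k => by simp only [Function.comp]; linarith [hrec' k]) h1

/-! ### Pathwise convergence under summable relative errors -/

section Convergence

variable {n : ℕ} {X : Set (Vec n)} {a : Params} {H : Vec n → Vec n}

/-- The counter grows by one exactly when a weight is charged, so each term of ∑ (νm^(-τ))² is used
at most once; that series converges because 2τ > 1. -/
theorem summable_accelWeight (ha : a.Admissible) {h g : ℕ → Vec n → Vec n} {s : ℕ → State n}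
    (hs : ∀ k, s (k + 1) = step a X (h k) (g k) (s k)) :
    Summable fun k => accelWeight a (s k) (s (k + 1)) := by
  set f : ℕ → ℝ := fun m => (a.ν * (m : ℝ) ^ (-a.τ)) ^ 2 with hf
  have hfs : Summable f := by
    have h1 : f = fun m : ℕ => a.ν ^ 2 * (m : ℝ) ^ (-a.τ * 2) := by
      funext m
      simp only [hf]
      rw [mul_pow, Real.rpow_mul (Nat.cast_nonneg m), Real.rpow_two]
    rw [h1]
    exact (Real.summable_nat_rpow.2 (by linarith [ha.τ_gt])).mul_left _
  have hf0 : ∀ m, 0 ≤ f m := fun m => sq_nonneg _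
  refine summable_of_sum_range_le (c := ∑' m, f m) (fun k => accelWeight_nonneg _ _) fun K => ?_
  refine le_trans ?_ (hfs.sum_le_tsum (Finset.range (s K).θ) fun i _ => hf0 i)
  induction K with
  | zero => simpa using Finset.sum_nonneg fun i _ => hf0 i
  | succ K ih =>
    rw [Finset.sum_range_succ]
    rcases step_theta (a := a) (X := X) (hξ := h K) (hη := g K) (s K) with h1 | h1 <;>
      rw [← hs K] at h1
    · rw [h1, accelWeight, if_neg (by omega), add_zero]
      exact ih
    · rw [accelWeight, if_pos h1, h1, Finset.sum_range_succ]
      gcongr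

/-- The norm of the correlated error at the trial point of the line search. -/
theorem correlated_error_le (hX : IsClosed X) (hc : Convex ℝ X) (hne : X.Nonempty)
    {h : Vec n → Vec n} {LH Λ t e₁ e₂ : ℝ} (hLH : 0 ≤ LH) (hΛ : 0 ≤ Λ)
    (hH : ∀ x y, ‖H x - H y‖ ≤ LH * ‖x - y‖) (hh : ∀ x y, ‖h x - h y‖ ≤ Λ * ‖x - y‖)
    (ht : 0 ≤ t) (ht1 : t ≤ 1) {x : Vec n} (h1 : ‖h x - H x‖ ≤ e₁)
    (h2 : ‖h (projStep X H t x) - H (projStep X H t x)‖ ≤ e₂) :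
    ‖h (projStep X h t x) - H (projStep X h t x)‖ ≤ e₂ + (Λ + LH) * e₁ := by
  set y := projStep X h t x
  set z := projStep X H t x
  have hyz : ‖y - z‖ ≤ e₁ := by
    calc ‖y - z‖ ≤ t * ‖h x - H x‖ := norm_projStep_sub_projStep_le hX hc hne h H ht x
      _ ≤ 1 * ‖h x - H x‖ := by gcongr
      _ ≤ e₁ := by rwa [one_mul]
  calc ‖h y - H y‖ = ‖(h y - h z) + (h z - H z) - (H y - H z)‖ := by congr 1; abel
    _ ≤ ‖h y - h z‖ + ‖h z - H z‖ + ‖H y - H z‖ :=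
      (norm_sub_le _ _).trans (by gcongr; exact norm_add_le _ _)
    _ ≤ Λ * ‖y - z‖ + e₂ + LH * ‖y - z‖ := by
      gcongr
      · exact hh _ _
      · exact hH _ _
    _ ≤ Λ * e₁ + e₂ + LH * e₁ := by gcongr
    _ = _ := by ring

/-- The trial point of the line search grows at most linearly. -/
theorem norm_projStep_sub_le (hX : IsClosed X) (hc : Convex ℝ X)
    {h : Vec n → Vec n} {LH R t : ℝ} (hLH : 0 ≤ LH)
    (hH : ∀ x y, ‖H x - H y‖ ≤ LH * ‖x - y‖) (ht : 0 ≤ t) (ht1 : t ≤ 1)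
    {x xs : Vec n} (hxs : xs ∈ X) (h1 : ‖h x - H x‖ ≤ R * (1 + ‖x‖)) :
    ‖projStep X h t x - xs‖ ≤ (1 + ‖xs‖ + R + ‖H 0‖ + LH) * (1 + ‖x‖) := by
  have i1 : ‖projStep X h t x - xs‖ ≤ ‖x - t • h x - xs‖ := by
    have := norm_proj_sub_proj_le hX hc ⟨xs, hxs⟩ (x - t • h x) xs
    rwa [proj_eq_self hX hxs] at this
  have i2 : ‖h x‖ ≤ ‖h x - H x‖ + (‖H x - H 0‖ + ‖H 0‖) := by
    calc _ = ‖h x - H x + ((H x - H 0) + H 0)‖ := by congr 1; abel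
      _ ≤ _ := (norm_add_le _ _).trans (by gcongr; exact norm_add_le _ _)
  have i3 := hH x 0
  rw [sub_zero] at i3
  have i4 : ‖t • h x‖ ≤ ‖h x‖ := by
    rw [norm_smul, Real.norm_of_nonneg ht]
    exact mul_le_of_le_one_left (norm_nonneg _) ht1
  have i5 : ‖x - t • h x - xs‖ ≤ ‖x‖ + ‖t • h x‖ + ‖xs‖ :=
    (norm_sub_le _ _).trans (by gcongr; exact norm_sub_le _ _)
  have i6 := norm_nonneg x
  have i7 := mul_nonneg (norm_nonneg xs) i6
  have i8 := mul_nonneg (norm_nonneg (H 0)) i6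
  linarith

/-- One iteration as a quasi-Fejér step, in terms of the relative errors. -/
theorem step_quasiFejer (hX : IsClosed X) (hc : Convex ℝ X) (hp : PseudomonotoneOn H X)
    (ha : a.Admissible) {LH Λ R K₂ K₃ e₁ e₂ e₃ : ℝ} (hLH : 0 ≤ LH) (hΛ : 0 ≤ Λ) (hR : 0 ≤ R)
    (hH : ∀ x y, ‖H x - H y‖ ≤ LH * ‖x - y‖) {h g : Vec n → Vec n}
    (hh : ∀ x y, ‖h x - h y‖ ≤ Λ * ‖x - y‖) {xs : Vec n} (hxs : xs ∈ SOL X H)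
    (hK₂ : K₂ = 1 + ‖xs‖ + R + ‖H 0‖ + LH) (hK₃ : K₃ = 1 + K₂ + ‖xs‖) {s : State n} {y : Vec n}
    (hy : y = projStep X h (stepsize a X h s.x) s.x) (n₃ : 0 ≤ e₃) (he₁ : e₁ ≤ R)
    (h₁ : ‖h s.x - H s.x‖ ≤ e₁ * (1 + ‖s.x‖))
    (h₂ : ∀ m : ℕ, ‖h (projStep X H (a.γ * a.ρ ^ m) s.x)
      - H (projStep X H (a.γ * a.ρ ^ m) s.x)‖ ≤ e₂ * (1 + ‖s.x‖))
    (h₃ : ‖g y - H y‖ ≤ e₃ * (1 + ‖y‖)) :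
    ‖(step a X h g s).x - xs‖ ^ 2 ≤ ‖s.x - xs‖ ^ 2
      + ((1 + a.M) * (2 * (1 + ‖xs‖) ^ 2) * (3 * (e₂ + (Λ + LH) * e₁) ^ 2
          + 3 * (K₃ ^ 2 * e₃ ^ 2) + 2 * (K₃ * K₂) * e₃)
        + a.M * (1 + a.M) * accelWeight a s (step a X h g s)) * (1 + ‖s.x - xs‖ ^ 2)
      - (1 - 3 * a.μ ^ 2) / 2 * ‖y - s.x‖ ^ 2 := by
  have hM := ha.M_pos
  have hne : X.Nonempty := ⟨xs, hxs.1⟩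
  have hstep := step_fejer (hη := g) hX hc hp ha hh hxs s hy
  have hu1 : 1 ≤ 1 + ‖s.x‖ := by linarith [norm_nonneg s.x]
  have hγ0 := (stepsize_pos (X := X) (h := h) ha s.x).le
  have hγ1 := (stepsize_le (X := X) (h := h) ha s.x).trans ha.γ_le_one
  have hK₂0 : 0 ≤ K₂ := by rw [hK₂]; positivity
  have hK₃0 : 0 ≤ K₃ := by rw [hK₃]; positivity
  -- The stepsize is γρ^m for an exponent m chosen by the search. As `h₂` holds for all m, it
  -- applies to this sample-dependent choice.
  have hB := correlated_error_le hX hc hne hLH hΛ hH hh hγ0 hγ1 h₁ (h₂ _)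
  have hyxs := norm_projStep_sub_le (h := h) (R := R) hX hc hLH hH hγ0 hγ1 hxs.1
    (h₁.trans (by gcongr))
  rw [← hK₂] at hyxs
  rw [← hy] at hB hyxs
  -- The errors scale with the size of the iterate; this rewrites that size in terms of the Lyapunov
  -- quantity.
  have hu2 : (1 + ‖s.x‖) ^ 2 ≤ 2 * (1 + ‖xs‖) ^ 2 * (1 + ‖s.x - xs‖ ^ 2) := by
    have i1 : 1 + ‖s.x‖ ≤ (1 + ‖xs‖) * (1 + ‖s.x - xs‖) := by
      have : ‖s.x‖ ≤ ‖s.x - xs‖ + ‖xs‖ := by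
        calc _ = ‖(s.x - xs) + xs‖ := by congr 1; abel
          _ ≤ _ := norm_add_le _ _
      nlinarith [norm_nonneg xs, norm_nonneg (s.x - xs)]
    calc (1 + ‖s.x‖) ^ 2 ≤ ((1 + ‖xs‖) * (1 + ‖s.x - xs‖)) ^ 2 := by gcongr
      _ = (1 + ‖xs‖) ^ 2 * (1 + ‖s.x - xs‖) ^ 2 := by ring
      _ ≤ (1 + ‖xs‖) ^ 2 * (2 * (1 + ‖s.x - xs‖ ^ 2)) := by
        gcongr
        nlinarith [sq_nonneg (1 - ‖s.x - xs‖)]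
      _ = _ := by ring
  have hC : ‖g y - H y‖ ≤ e₃ * (K₃ * (1 + ‖s.x‖)) := by
    refine h₃.trans ?_
    gcongr
    have i1 : ‖y‖ ≤ ‖y - xs‖ + ‖xs‖ := by
      calc _ = ‖(y - xs) + xs‖ := by congr 1; abel
        _ ≤ _ := norm_add_le _ _
    have i2 := mul_nonneg (norm_nonneg xs) (norm_nonneg s.x)
    have i3 := norm_nonneg s.x
    rw [hK₃]
    linarith
  have hB' : ‖h y - H y‖ ≤ (e₂ + (Λ + LH) * e₁) * (1 + ‖s.x‖) := by
    linarith
  generalize 1 + ‖s.x‖ = u at *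
  generalize e₂ + (Λ + LH) * e₁ = b at *
  have hE : 3 * ‖h y - H y‖ ^ 2 + 3 * ‖g y - H y‖ ^ 2 + 2 * ‖g y - H y‖ * ‖y - xs‖
      ≤ (3 * b ^ 2 + 3 * (K₃ ^ 2 * e₃ ^ 2) + 2 * (K₃ * K₂) * e₃) * u ^ 2 := by
    calc _ ≤ 3 * (b * u) ^ 2 + 3 * (e₃ * (K₃ * u)) ^ 2
          + 2 * (e₃ * (K₃ * u)) * (K₂ * u) := by gcongr
      _ = _ := by ring
  have hε : 0 ≤ 3 * b ^ 2 + 3 * (K₃ ^ 2 * e₃ ^ 2) + 2 * (K₃ * K₂) * e₃ := by positivity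
  generalize 3 * b ^ 2 + 3 * (K₃ ^ 2 * e₃ ^ 2) + 2 * (K₃ * K₂) * e₃ = ε at *
  generalize 3 * ‖h y - H y‖ ^ 2 + 3 * ‖g y - H y‖ ^ 2 + 2 * ‖g y - H y‖ * ‖y - xs‖ = E at *
  have hE2 : (1 + a.M) * E
      ≤ (1 + a.M) * (2 * (1 + ‖xs‖) ^ 2) * ε * (1 + ‖s.x - xs‖ ^ 2) := by
    calc _ ≤ (1 + a.M) * (ε * (2 * (1 + ‖xs‖) ^ 2 * (1 + ‖s.x - xs‖ ^ 2))) := by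
          gcongr
          exact hE.trans (by gcongr)
      _ = _ := by ring
  have hw0 : 0 ≤ a.M * (1 + a.M) * accelWeight a s (step a X h g s) := by
    have := accelWeight_nonneg (a := a) s (step a X h g s)
    positivity
  have hw1 := le_mul_of_one_le_right hw0
    (show 1 ≤ 1 + ‖s.x - xs‖ ^ 2 by linarith [sq_nonneg ‖s.x - xs‖])
  linarith

/-- Pathwise convergence of the algorithm when the estimation errors, relative to the size of
the iterates, are summable. -/
theorem tendsto_of_summable_errors (hX : IsClosed X) (hc : Convex ℝ X)
    (hp : PseudomonotoneOn H X) (ha : a.Admissible) (hSOL : (SOL X H).Nonempty)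
    {LH : ℝ} (hLH : 0 ≤ LH) (hH : ∀ x y, ‖H x - H y‖ ≤ LH * ‖x - y‖)
    {h g : ℕ → Vec n → Vec n} {s : ℕ → State n}
    (hs : ∀ k, s (k + 1) = step a X (h k) (g k) (s k))
    {Λ : ℝ} (hΛ : 0 < Λ) (hh : ∀ k x y, ‖h k x - h k y‖ ≤ Λ * ‖x - y‖)
    {e₁ e₂ e₃ : ℕ → ℝ} (he₁ : Summable e₁) (he₂ : Summable e₂) (he₃ : Summable e₃)
    (h₁ : ∀ k, ‖h k (s k).x - H (s k).x‖ ≤ e₁ k * (1 + ‖(s k).x‖))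
    (h₂ : ∀ k (m : ℕ), ‖h k (projStep X H (a.γ * a.ρ ^ m) (s k).x)
      - H (projStep X H (a.γ * a.ρ ^ m) (s k).x)‖ ≤ e₂ k * (1 + ‖(s k).x‖))
    (h₃ : ∀ k, ‖g k (projStep X (h k) (stepsize a X (h k) (s k).x) (s k).x)
      - H (projStep X (h k) (stepsize a X (h k) (s k).x) (s k).x)‖
      ≤ e₃ k * (1 + ‖projStep X (h k) (stepsize a X (h k) (s k).x) (s k).x‖)) :
    (∃ xlim ∈ SOL X H, Tendsto (fun k => (s k).x) atTop (𝓝 xlim)) ∧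
      Tendsto (fun k => residual X H a.γ (s k).x) atTop (𝓝 0) := by
  have hne : X.Nonempty := hSOL.mono fun x hx => hx.1
  set x : ℕ → Vec n := fun k => (s k).x with hxdef
  set y : ℕ → Vec n := fun k => projStep X (h k) (stepsize a X (h k) (s k).x) (s k).x
  have n₁ : ∀ k, 0 ≤ e₁ k := fun k =>
    nonneg_of_mul_nonneg_left ((norm_nonneg _).trans (h₁ k)) (by positivity)
  have n₂ : ∀ k, 0 ≤ e₂ k := fun k =>
    nonneg_of_mul_nonneg_left ((norm_nonneg _).trans (h₂ k 0)) (by positivity)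
  have n₃ : ∀ k, 0 ≤ e₃ k := fun k =>
    nonneg_of_mul_nonneg_left ((norm_nonneg _).trans (h₃ k)) (by positivity)
  have sq_summable : ∀ {f : ℕ → ℝ}, Summable f → (∀ k, 0 ≤ f k) →
      Summable fun k => f k ^ 2 := by
    intro f hf hf0
    have h1 : ∀ k, f k ≤ ∑' i, f i := fun k => hf.le_tsum k fun i _ => hf0 i
    refine Summable.of_nonneg_of_le (fun k => sq_nonneg _) (fun k => ?_)
      (hf.mul_right (∑' i, f i))
    rw [sq]
    exact mul_le_mul_of_nonneg_left (h1 k) (hf0 k)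
  have hM := ha.M_pos
  have hμ3 := ha.one_sub_pos
  -- convergence of the distances to every solution
  have main : ∀ xs ∈ SOL X H, (∃ l, Tendsto (fun k => ‖x k - xs‖ ^ 2) atTop (𝓝 l)) ∧
      Tendsto (fun k => (1 - 3 * a.μ ^ 2) / 2 * ‖y k - x k‖ ^ 2) atTop (𝓝 0) := by
    intro xs hxs
    set R₁ := ∑' k, e₁ k
    have hR₁ : ∀ k, e₁ k ≤ R₁ := fun k => he₁.le_tsum k fun i _ => n₁ i
    set K₂ := 1 + ‖xs‖ + R₁ + ‖H 0‖ + LH with hK₂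
    have hR₁0 : 0 ≤ R₁ := (n₁ 0).trans (hR₁ 0)
    have hK₂0 : 0 ≤ K₂ := by positivity
    set K₃ := 1 + K₂ + ‖xs‖ with hK₃
    have hK₃0 : 0 ≤ K₃ := by positivity
    set b : ℕ → ℝ := fun k => e₂ k + (Λ + LH) * e₁ k with hb
    have hb0 : ∀ k, 0 ≤ b k := fun k => by have := n₁ k; have := n₂ k; positivity
    have hbs : Summable b := he₂.add (he₁.mul_left _)
    set ε : ℕ → ℝ := fun k => 3 * b k ^ 2 + 3 * (K₃ ^ 2 * e₃ k ^ 2) + 2 * (K₃ * K₂) * e₃ k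
      with hε
    have hεs : Summable ε :=
      (((sq_summable hbs hb0).mul_left _).add
        (((sq_summable he₃ n₃).mul_left _).mul_left _)).add (he₃.mul_left _)
    have hε0 : ∀ k, 0 ≤ ε k := fun k => by have := n₃ k; positivity
    set w : ℕ → ℝ := fun k => a.M * (1 + a.M) * accelWeight a (s k) (s (k + 1)) with hw
    have hws : Summable w := (summable_accelWeight ha hs).mul_left _
    have hw0 : ∀ k, 0 ≤ w k := fun k => by
      have := accelWeight_nonneg (a := a) (s k) (s (k + 1))
      positivity
    refine quasiFejer_tendsto (δ := fun k => (1 + a.M) * (2 * (1 + ‖xs‖) ^ 2) * ε k + w k)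
      (fun k => by positivity) (fun k => by positivity)
      (fun k => by have := hε0 k; have := hw0 k; positivity)
      ((hεs.mul_left _).add hws) fun k => ?_
    simp only [hxdef, hw, hs k]
    exact step_quasiFejer hX hc hp ha hLH hΛ.le hR₁0 hH (hh k) hxs hK₂ hK₃ rfl (n₃ k)
      (hR₁ k) (h₁ k) (h₂ k) (h₃ k)
  obtain ⟨x₁, hx₁⟩ := hSOL
  obtain ⟨⟨l₁, hl₁⟩, hF⟩ := main x₁ hx₁
  have hbound : ∃ R, ∀ k, ‖x k‖ ≤ R := by
    obtain ⟨R, hR⟩ := hl₁.bddAbove_range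
    refine ⟨1 + R + ‖x₁‖, fun k => ?_⟩
    have i1 : ‖x k - x₁‖ ^ 2 ≤ R := hR ⟨k, rfl⟩
    have i2 : ‖x k‖ ≤ ‖x k - x₁‖ + ‖x₁‖ := by
      calc _ = ‖(x k - x₁) + x₁‖ := by congr 1; abel
        _ ≤ _ := norm_add_le _ _
    nlinarith [sq_nonneg (‖x k - x₁‖ - 1)]
  obtain ⟨R, hR⟩ := hbound
  have hF' : Tendsto (fun k => ‖y k - x k‖) atTop (𝓝 0) := by
    have i1 := hF.const_mul ((1 - 3 * a.μ ^ 2) / 2)⁻¹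
    simp only [inv_mul_cancel_left₀ hμ3.ne', mul_zero] at i1
    simpa [Real.sqrt_sq] using i1.sqrt
  have hres : Tendsto (fun k => residual X H a.γ (x k)) atTop (𝓝 0) := by
    -- A lower bound for all stepsizes. Sublinearity of the residual transfers the decay of ‖y - x‖
    -- at the actual step to step γ; the error at x replaces the estimator by `H`.
    set t₀ := min a.γ (a.ρ * a.μ / Λ)
    have ht₀ : 0 < t₀ := lt_min ha.γ_pos (div_pos (mul_pos ha.ρ_pos ha.μ_pos) hΛ)
    have hlim : Tendsto (fun k => a.γ / t₀ * ‖y k - x k‖ + e₁ k * (1 + R)) atTop (𝓝 0) := by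
      simpa using (hF'.const_mul (a.γ / t₀)).add (he₁.tendsto_atTop_zero.mul_const (1 + R))
    refine squeeze_zero (fun k => norm_nonneg _) (fun k => ?_) hlim
    have i1 := (residual_le_and_mul_le hX hc hne (h k)
      (stepsize_pos ha (x k)) (stepsize_le (X := X) (h := h k) ha (x k)) (x k)).2
    have i2 : t₀ * residual X (h k) a.γ (x k) ≤ a.γ * ‖y k - x k‖ := by
      refine le_trans ?_ i1
      have : 0 ≤ residual X (h k) a.γ (x k) := norm_nonneg _
      gcongr
      exact min_le_stepsize ha hΛ (hh k) (x k)
    have i3 : residual X (h k) a.γ (x k) ≤ a.γ / t₀ * ‖y k - x k‖ := by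
      rw [div_mul_eq_mul_div, le_div_iff₀ ht₀]
      linarith
    have i4 : residual X H a.γ (x k)
        ≤ ‖projStep X (h k) a.γ (x k) - projStep X H a.γ (x k)‖ + residual X (h k) a.γ (x k) := by
      unfold residual
      rw [norm_sub_rev (projStep X (h k) a.γ (x k))]
      calc _ = ‖(projStep X H a.γ (x k) - projStep X (h k) a.γ (x k))
            + (projStep X (h k) a.γ (x k) - x k)‖ := by congr 1; abel
        _ ≤ _ := norm_add_le _ _
    have i5 : ‖projStep X (h k) a.γ (x k) - projStep X H a.γ (x k)‖ ≤ e₁ k * (1 + R) := by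
      calc _ ≤ a.γ * ‖h k (x k) - H (x k)‖ :=
            norm_projStep_sub_projStep_le hX hc hne _ _ ha.γ_pos.le _
        _ ≤ 1 * ‖h k (x k) - H (x k)‖ := by gcongr; exact ha.γ_le_one
        _ ≤ e₁ k * (1 + ‖x k‖) := by rw [one_mul]; exact h₁ k
        _ ≤ _ := by have := n₁ k; gcongr; exact hR k
    linarith
  refine ⟨?_, hres⟩
  obtain ⟨xlim, -, φ, hφ, hxlim⟩ := tendsto_subseq_of_bounded
    (s := Metric.closedBall 0 R) Metric.isBounded_closedBall (x := x)
    (fun k => by simpa using hR k)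
  have hHc : Continuous H := (LipschitzWith.of_dist_le_mul (K := LH.toNNReal) fun x y => by
    rw [dist_eq_norm, dist_eq_norm, Real.coe_toNNReal _ hLH]; exact hH x y).continuous
  have hsol : xlim ∈ SOL X H := by
    refine mem_SOL_of_residual_eq_zero hX hc hne ha.γ_pos (tendsto_nhds_unique ?_
      (hres.comp hφ.tendsto_atTop))
    exact ((continuous_residual hX hc hne hHc a.γ).tendsto xlim).comp hxlim
  refine ⟨xlim, hsol, ?_⟩
  -- The distance to the cluster point itself converges, and along the subsequence its limit is 0.
  obtain ⟨⟨l, hl⟩, -⟩ := main xlim hsol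
  have hl0 : l = 0 := by
    refine tendsto_nhds_unique (hl.comp hφ.tendsto_atTop) ?_
    have := (tendsto_iff_norm_sub_tendsto_zero.1 hxlim).pow 2
    simpa [Function.comp_def] using this
  rw [tendsto_iff_norm_sub_tendsto_zero]
  have i1 := hl.sqrt
  simpa [hl0, Real.sqrt_sq] using i1

end Convergence

/-! ### Mean deviation of sample means -/

section SampleMean

variable {Ω Ξ : Type*} [MeasurableSpace Ω] [MeasurableSpace Ξ] {P : Measure Ω}
  [IsProbabilityMeasure P] {ξ : Ω → Ξ} {N : ℕ} {u : Fin N → Ω → Ξ}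

/-- The mean absolute deviation of a real sample mean. -/
theorem lintegral_sampleMean_le (hN : 0 < N) (hu : iIndepFun u P)
    (hid : ∀ j, IdentDistrib (u j) ξ P P) {f : Ξ → ℝ} (hf : Measurable f)
    (hL2 : MemLp (fun ω => f (ξ ω)) 2 P) {B : ℝ} (hB : 0 ≤ B)
    (hvar : ∫ ω, f (ξ ω) ^ 2 ∂P ≤ B ^ 2) :
    ∫⁻ ω, ‖(N : ℝ)⁻¹ * ∑ j, f (u j ω) - ∫ ω', f (ξ ω') ∂P‖ₑ ∂P
      ≤ ENNReal.ofReal (B / √(N : ℝ)) := by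
  have hN' : (0 : ℝ) < N := by exact_mod_cast hN
  have hidf : ∀ j, IdentDistrib (f ∘ u j) (f ∘ ξ) P P := fun j => (hid j).comp hf
  have hmem : ∀ j, MemLp (f ∘ u j) 2 P := fun j => (hidf j).memLp_iff.2 hL2
  have hind : iIndepFun (fun j => f ∘ u j) P := hu.comp (fun _ => f) fun _ => hf
  set A : Ω → ℝ := ∑ j, f ∘ u j with hA
  have hAmem : MemLp A 2 P := memLp_finsetSum' _ fun j _ => hmem j
  have hVarA : Var[A; P] ≤ N * B ^ 2 := by
    rw [hA, IndepFun.variance_sum (fun j _ => hmem j)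
      (fun i _ j _ hij => hind.indepFun hij)]
    calc ∑ j, Var[f ∘ u j; P] ≤ ∑ _j : Fin N, B ^ 2 := by
          refine Finset.sum_le_sum fun j _ => ?_
          rw [(hidf j).variance_eq]
          exact (variance_le_expectation_sq hL2.aestronglyMeasurable).trans hvar
      _ = N * B ^ 2 := by simp
  have hEA : ∫ ω, A ω ∂P = N * ∫ ω', f (ξ ω') ∂P := by
    simp only [hA, Finset.sum_apply]
    rw [integral_finsetSum _ fun j _ => (hmem j).integrable one_le_two]
    rw [Finset.sum_congr rfl fun j _ => (hidf j).integral_eq]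
    simp
  set Z : Ω → ℝ := fun ω => (N : ℝ)⁻¹ * A ω - ∫ ω', f (ξ ω') ∂P with hZ
  have hZmem : MemLp Z 2 P := (hAmem.const_mul _).sub (memLp_const _)
  have hEZ2 : ∫ ω, Z ω ^ 2 ∂P ≤ B ^ 2 / N := by
    have h1 : ∀ ω, Z ω ^ 2 = ((N : ℝ)⁻¹) ^ 2 * (A ω - ∫ ω, A ω ∂P) ^ 2 := fun ω => by
      rw [hEA, ← mul_pow, mul_sub, inv_mul_cancel_left₀ hN'.ne']
    simp_rw [h1]
    rw [integral_const_mul, ← variance_eq_integral hAmem.aestronglyMeasurable.aemeasurable]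
    calc _ ≤ ((N : ℝ)⁻¹) ^ 2 * (N * B ^ 2) := by gcongr
      _ = _ := by field_simp
  have hEZ : ∫ ω, ‖Z ω‖ ∂P ≤ B / √(N : ℝ) := by
    -- Nonnegativity of the variance of |Z| is (E|Z|)² ≤ E[Z²].
    have h1 := variance_nonneg (fun ω => ‖Z ω‖) P
    rw [variance_eq_sub hZmem.norm] at h1
    simp only [Pi.pow_apply, Real.norm_eq_abs, sq_abs] at h1
    refine abs_le_of_sq_le_sq' (a := ∫ ω, ‖Z ω‖ ∂P) ?_ (by positivity) |>.2
    rw [div_pow, Real.sq_sqrt hN'.le]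
    simp only [Real.norm_eq_abs]
    linarith
  calc _ = ∫⁻ ω, ‖Z ω‖ₑ ∂P := by simp [hZ, hA]
    _ = ENNReal.ofReal (∫ ω, ‖Z ω‖ ∂P) :=
      (ofReal_integral_norm_eq_lintegral_enorm (hZmem.integrable one_le_two)).symm
    _ ≤ _ := ENNReal.ofReal_le_ofReal hEZ

theorem norm_le_sum_abs {n : ℕ} (v : Vec n) : ‖v‖ ≤ ∑ i, |v i| := by
  calc ‖v‖ = ‖∑ i, v i • EuclideanSpace.basisFun (Fin n) ℝ i‖ := by
        congr 1
        exact ((EuclideanSpace.basisFun (Fin n) ℝ).sum_repr v).symm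
    _ ≤ ∑ i, ‖v i • EuclideanSpace.basisFun (Fin n) ℝ i‖ := norm_sum_le _ _
    _ = _ := by simp [norm_smul]

/-- The mean deviation of a vector-valued sample mean. -/
theorem lintegral_sampleMean_vec_le {n : ℕ} (hN : 0 < N) (hum : ∀ j, Measurable (u j))
    (hu : iIndepFun u P)
    (hid : ∀ j, IdentDistrib (u j) ξ P P) {f : Ξ → Vec n} (hf : Measurable f)
    (hL2 : MemLp (fun ω => f (ξ ω)) 2 P) {B : ℝ} (hB : 0 ≤ B)
    (hvar : ∫ ω, ‖f (ξ ω)‖ ^ 2 ∂P ≤ B ^ 2) :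
    ∫⁻ ω, ‖(N : ℝ)⁻¹ • ∑ j, f (u j ω) - ∫ ω', f (ξ ω') ∂P‖ₑ ∂P
      ≤ ENNReal.ofReal (n * B / √(N : ℝ)) := by
  have hint : Integrable (fun ω => f (ξ ω)) P := hL2.integrable one_le_two
  have hcoord : ∀ i, (∫ ω', f (ξ ω') ∂P) i = ∫ ω', f (ξ ω') i ∂P := fun i =>
    ((EuclideanSpace.proj (𝕜 := ℝ) i).integral_comp_comm hint).symm
  have hfi : ∀ i, Measurable fun s => f s i := fun i =>
    (EuclideanSpace.proj i : Vec n →L[ℝ] ℝ).continuous.measurable.comp hf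
  have hle : ∀ i ω, ‖f (ξ ω) i‖ ≤ ‖f (ξ ω)‖ := fun i ω => PiLp.norm_apply_le _ _
  have hmem : ∀ i, MemLp (fun ω => f (ξ ω) i) 2 P := fun i =>
    hL2.mono ((EuclideanSpace.proj (𝕜 := ℝ) i).continuous.comp_aestronglyMeasurable
      hL2.aestronglyMeasurable) (ae_of_all _ (hle i))
  have hi : ∀ i, ∫⁻ ω, ‖(N : ℝ)⁻¹ * ∑ j, f (u j ω) i - ∫ ω', f (ξ ω') i ∂P‖ₑ ∂P
      ≤ ENNReal.ofReal (B / √(N : ℝ)) := fun i => by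
    refine lintegral_sampleMean_le hN hu hid (hfi i) (hmem i) hB (le_trans ?_ hvar)
    refine integral_mono (hmem i).integrable_sq hL2.integrable_norm_pow' fun ω => ?_
    simp only
    rw [← sq_abs]
    gcongr
    exact hle i ω
  -- The norm is bounded by the sum of the coordinates' absolute values, which costs the factor n.
  calc _ ≤ ∫⁻ ω, ∑ i, ‖(N : ℝ)⁻¹ * ∑ j, f (u j ω) i - ∫ ω', f (ξ ω') i ∂P‖ₑ ∂P := by
        refine lintegral_mono fun ω => ?_
        rw [← ofReal_norm]
        refine (ENNReal.ofReal_le_ofReal (norm_le_sum_abs _)).trans ?_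
        rw [ENNReal.ofReal_sum_of_nonneg fun i _ => abs_nonneg _]
        refine Finset.sum_le_sum fun i _ => ?_
        rw [← Real.norm_eq_abs, ofReal_norm]
        simp [hcoord]
    _ = ∑ i, ∫⁻ ω, ‖(N : ℝ)⁻¹ * ∑ j, f (u j ω) i - ∫ ω', f (ξ ω') i ∂P‖ₑ ∂P := by
        refine lintegral_finsetSum _ fun i _ => ?_
        have := fun j => (hfi i).comp (hum j)
        simp only [Function.comp_def] at this
        fun_prop
    _ ≤ ∑ _i : Fin n, ENNReal.ofReal (B / √(N : ℝ)) := Finset.sum_le_sum fun i _ => hi i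
    _ = _ := by
      rw [Finset.sum_const, Finset.card_univ, Fintype.card_fin, mul_div_assoc,
        ENNReal.ofReal_mul (Nat.cast_nonneg n), ENNReal.ofReal_natCast, nsmul_eq_mul]

end SampleMean

/-! ### Second moments of the random operator -/

section Moments

variable {n : ℕ} {Ω Ξ : Type*} [MeasurableSpace Ω] [MeasurableSpace Ξ] {P : Measure Ω}
  [IsProbabilityMeasure P] {T : Ξ → Vec n → Vec n} {ξ : Ω → Ξ}

/-- Pointwise f² ≤ f^(2r) + 1, by comparing f with 1. -/
theorem memLp_two_of_integrable_rpow {f : Ω → ℝ} (hf : AEStronglyMeasurable f P)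
    (hf0 : ∀ᵐ ω ∂P, 0 ≤ f ω) {r : ℝ} (hr : 2 ≤ r)
    (hint : Integrable (fun ω => f ω ^ (2 * r)) P) : MemLp f 2 P := by
  rw [memLp_two_iff_integrable_sq hf]
  refine Integrable.mono' (hint.add (integrable_const (1 : ℝ))) (hf.pow 2) ?_
  filter_upwards [hf0] with ω h0
  rw [Real.norm_of_nonneg (sq_nonneg _)]
  simp only [Pi.add_apply]
  rcases le_total (f ω) 1 with h | h
  · have := Real.rpow_nonneg h0 (2 * r)
    nlinarith
  · have : f ω ^ (2 : ℝ) ≤ f ω ^ (2 * r) := Real.rpow_le_rpow_of_exponent_le h (by linarith)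
    rw [Real.rpow_two] at this
    linarith

/-- The consequences of the moment conditions that the convergence proof uses. -/
structure SecondMoments (P : Measure Ω) (T : Ξ → Vec n → Vec n) (ξ : Ω → Ξ) (L : Ξ → ℝ)
    (C : ℝ) : Prop where
  measurable_L : Measurable L
  memLp_L : MemLp (fun ω => L (ξ ω)) 2 P
  lipschitz : ∀ᵐ s ∂(P.map ξ), ∀ x y : Vec n, ‖T s x - T s y‖ ≤ L s * ‖x - y‖
  integral_nonneg : 0 ≤ ∫ ω, L (ξ ω) ∂P
  lipschitz_mean : ∀ x y, ‖meanOp P T ξ x - meanOp P T ξ y‖ ≤ (∫ ω, L (ξ ω) ∂P) * ‖x - y‖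
  const_nonneg : 0 ≤ C
  integral_sq_L : ∫ ω, L (ξ ω) ^ 2 ∂P ≤ C ^ 2
  memLp : ∀ x, MemLp (fun ω => T (ξ ω) x) 2 P
  integral_sq : ∀ x, ∫ ω, ‖T (ξ ω) x‖ ^ 2 ∂P ≤ (C * (1 + ‖x‖)) ^ 2
  integral_sq_sub : ∀ x y, ∫ ω, ‖T (ξ ω) x - T (ξ ω) y‖ ^ 2 ∂P ≤ (C * ‖x - y‖) ^ 2

theorem LipschitzMoment.exists_secondMoments (hT : Measurable (Function.uncurry T))
    (hξ : Measurable ξ) (h : LipschitzMoment P T ξ) : ∃ L C, SecondMoments P T ξ L C := by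
  obtain ⟨⟨L, hLm, hL1, hLip, p, hp, hLp⟩, z, q, hq, hTq⟩ := h
  have hTm : ∀ x, Measurable fun ω => T (ξ ω) x := fun x =>
    hT.comp (hξ.prodMk measurable_const)
  have hLip' := ae_of_ae_map hξ.aemeasurable hLip
  have hL2 : MemLp (fun ω => L (ξ ω)) 2 P :=
    memLp_two_of_integrable_rpow (hLm.comp hξ).aestronglyMeasurable
      (hL1.mono fun ω h => by linarith) hp hLp
  have hT2 : MemLp (fun ω => ‖T (ξ ω) z‖) 2 P :=
    memLp_two_of_integrable_rpow (hTm z).norm.aestronglyMeasurable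
      (ae_of_all _ fun ω => norm_nonneg _) hq hTq
  -- A single square-integrable majorant: the Lipschitz bound around `z` gives ‖T(ξ,x)‖ ≤
  -- W(1+‖z‖)(1+‖x‖), and L ≤ W. The final constant is the L² norm of W times 1+‖z‖.
  set W : Ω → ℝ := fun ω => ‖T (ξ ω) z‖ + L (ξ ω) with hW
  have hW2 : MemLp W 2 P := hT2.add hL2
  obtain ⟨D, hD0, hD⟩ : ∃ D : ℝ, 0 ≤ D ∧ D ^ 2 = ∫ ω, W ω ^ 2 ∂P :=
    ⟨_, Real.sqrt_nonneg _, Real.sq_sqrt (integral_nonneg fun ω => sq_nonneg _)⟩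
  have hz0 := norm_nonneg z
  have hDC : D ^ 2 ≤ (D * (1 + ‖z‖)) ^ 2 :=
    pow_le_pow_left₀ hD0 (le_mul_of_one_le_right hD0 (by linarith)) 2
  have hbound : ∀ x, ∀ᵐ ω ∂P, ‖T (ξ ω) x‖ ≤ W ω * ((1 + ‖z‖) * (1 + ‖x‖)) := fun x => by
    filter_upwards [hLip', hL1] with ω h1 h2
    have i1 := h1 x z
    have i2 : ‖T (ξ ω) x‖ ≤ ‖T (ξ ω) x - T (ξ ω) z‖ + ‖T (ξ ω) z‖ := by
      calc _ = ‖(T (ξ ω) x - T (ξ ω) z) + T (ξ ω) z‖ := by congr 1; abel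
        _ ≤ _ := norm_add_le _ _
    have i3 : ‖x - z‖ ≤ (1 + ‖z‖) * (1 + ‖x‖) := by
      nlinarith [norm_sub_le x z, norm_nonneg x]
    have i4 : 1 ≤ (1 + ‖z‖) * (1 + ‖x‖) := by nlinarith [norm_nonneg x]
    calc ‖T (ξ ω) x‖ ≤ ‖T (ξ ω) z‖ * 1 + L (ξ ω) * ‖x - z‖ := by linarith
      _ ≤ ‖T (ξ ω) z‖ * ((1 + ‖z‖) * (1 + ‖x‖)) + L (ξ ω) * ((1 + ‖z‖) * (1 + ‖x‖)) := by gcongr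
      _ = _ := by rw [hW]; ring
  have hmem : ∀ x, MemLp (fun ω => T (ξ ω) x) 2 P := fun x =>
    (hW2.mul_const ((1 + ‖z‖) * (1 + ‖x‖))).mono' (hTm x).aestronglyMeasurable (hbound x)
  have hLW : ∫ ω, L (ξ ω) ^ 2 ∂P ≤ D ^ 2 := by
    rw [hD]
    refine integral_mono_ae hL2.integrable_sq hW2.integrable_sq ?_
    filter_upwards [hL1] with ω h1
    simp only [hW]
    gcongr
    linarith [norm_nonneg (T (ξ ω) z)]
  refine ⟨L, D * (1 + ‖z‖), hLm, hL2, hLip, ?_, fun x y => ?_, by positivity, hLW.trans hDC,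
    hmem, fun x => ?_, fun x y => ?_⟩
  · exact integral_nonneg_of_ae (hL1.mono fun ω h => by simp only [Pi.zero_apply]; linarith)
  · unfold meanOp
    rw [← integral_sub ((hmem x).integrable one_le_two) ((hmem y).integrable one_le_two),
      ← integral_mul_const]
    refine norm_integral_le_of_norm_le ((hL2.integrable one_le_two).mul_const _) ?_
    exact hLip'.mono fun ω h => h x y
  · calc _ ≤ ∫ ω, (W ω ^ 2) * ((1 + ‖z‖) * (1 + ‖x‖)) ^ 2 ∂P := by
          refine integral_mono_ae (hmem x).integrable_norm_pow'
            (hW2.integrable_sq.mul_const _) ?_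
          filter_upwards [hbound x] with ω h1
          rw [← mul_pow]
          gcongr
      _ = _ := by rw [integral_mul_const, ← hD]; ring
  · calc _ ≤ ∫ ω, (L (ξ ω) ^ 2) * ‖x - y‖ ^ 2 ∂P := by
          refine integral_mono_ae ((hmem x).sub (hmem y)).integrable_norm_pow'
            (hL2.integrable_sq.mul_const _) ?_
          filter_upwards [hLip'] with ω h1
          rw [← mul_pow]
          gcongr
          exact h1 x y
      _ = (∫ ω, L (ξ ω) ^ 2 ∂P) * ‖x - y‖ ^ 2 := integral_mul_const _ _
      _ ≤ (D * (1 + ‖z‖)) ^ 2 * ‖x - y‖ ^ 2 := by gcongr; exact hLW.trans hDC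
      _ = _ := by ring

end Moments

/-! ### Measurability of one iteration -/

section StepMeasurability

variable {n N : ℕ} {Ω Ξ : Type*} [MeasurableSpace Ω] [MeasurableSpace Ξ] {X : Set (Vec n)}
  {a : Params} {T : Ξ → Vec n → Vec n} {U V : Ω → Fin N → Ξ} {x : Ω → Vec n}

theorem measurable_empMean (hT : Measurable (Function.uncurry T)) (hU : Measurable U)
    (hx : Measurable x) : Measurable fun ω => empMean T (U ω) (x ω) := by
  unfold empMean
  have h : ∀ j, Measurable fun ω => T (U ω j) (x ω) := fun j =>
    hT.comp (((measurable_pi_apply j).comp hU).prodMk hx)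
  fun_prop

theorem measurable_projStep (hX : IsClosed X) (hc : Convex ℝ X) (hne : X.Nonempty)
    (hT : Measurable (Function.uncurry T)) (hU : Measurable U) (hx : Measurable x)
    {t : Ω → ℝ} (ht : Measurable t) :
    Measurable fun ω => projStep X (empMean T (U ω)) (t ω) (x ω) :=
  (continuous_proj hX hc hne).measurable.comp
    (hx.sub (ht.smul (measurable_empMean hT hU hx)))

theorem measurableSet_accepts (hX : IsClosed X) (hc : Convex ℝ X) (hne : X.Nonempty)
    (hT : Measurable (Function.uncurry T)) (hU : Measurable U) (hx : Measurable x) (t : ℝ) :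
    MeasurableSet {ω | Accepts a X (empMean T (U ω)) (x ω) t} := by
  have h1 := measurable_projStep hX hc hne hT hU hx (measurable_const (a := t))
  have h2 := measurable_empMean hT hU hx
  have h3 := measurable_empMean hT hU h1
  exact measurableSet_le ((h2.sub h3).norm.const_mul _) ((hx.sub h1).norm.const_mul _)

theorem measurable_sInf_nat {p : ℕ → Ω → Prop} (hp : ∀ m, MeasurableSet {ω | p m ω}) :
    Measurable fun ω => sInf {m | p m ω} := by
  have hlt : ∀ k, MeasurableSet {ω | ∀ j < k, ¬p j ω} := fun k => by
    simp only [Set.ofPred_forall]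
    exact MeasurableSet.iInter fun j => MeasurableSet.iInter fun _ => (hp j).compl
  refine measurable_to_countable' fun k => ?_
  -- Since `sInf ∅ = 0`, the fibre over 0 also contains the event that no index works.
  have : (fun ω => sInf {m | p m ω}) ⁻¹' {k}
      = ({ω | p k ω} ∩ {ω | ∀ j < k, ¬p j ω}) ∪ ({_ω | k = 0} ∩ {ω | ∀ j, ¬p j ω}) := by
    ext ω
    simp only [Set.mem_preimage, Set.mem_singleton_iff, Set.mem_union, Set.mem_inter_iff,
      Set.mem_ofPred_eq]
    constructor
    · intro h
      by_cases hne : {m | p m ω}.Nonempty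
      · left
        subst h
        exact ⟨Nat.sInf_mem hne, fun j hj => Nat.notMem_of_lt_sInf hj⟩
      · right
        rw [Set.not_nonempty_iff_eq_empty] at hne
        refine ⟨?_, fun j hj => ?_⟩
        · rw [← h, hne, Nat.sInf_empty]
        · exact (hne ▸ hj : j ∈ (∅ : Set ℕ))
    · rintro (⟨h1, h2⟩ | ⟨rfl, h2⟩)
      · refine le_antisymm (Nat.sInf_le h1) ?_
        by_contra! hlt
        exact h2 _ hlt (Nat.sInf_mem (s := {m | p m ω}) ⟨k, h1⟩)
      · have : {m | p m ω} = ∅ := Set.eq_empty_of_forall_notMem h2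
        rw [this, Nat.sInf_empty]
  rw [this]
  refine ((hp k).inter (hlt k)).union ((MeasurableSet.const _).inter ?_)
  simp only [Set.ofPred_forall]
  exact MeasurableSet.iInter fun j => (hp j).compl

theorem measurable_stepsize (hX : IsClosed X) (hc : Convex ℝ X) (hne : X.Nonempty)
    (hT : Measurable (Function.uncurry T)) (hU : Measurable U) (hx : Measurable x) :
    Measurable fun ω => stepsize a X (empMean T (U ω)) (x ω) := by
  have h1 := measurable_sInf_nat (p := fun m ω =>
    Accepts a X (empMean T (U ω)) (x ω) (a.γ * a.ρ ^ m))
    fun m => measurableSet_accepts hX hc hne hT hU hx _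
  exact (Measurable.of_discrete (f := fun m : ℕ => a.γ * a.ρ ^ m)).comp h1

theorem measurable_step (hX : IsClosed X) (hc : Convex ℝ X) (hne : X.Nonempty)
    (hT : Measurable (Function.uncurry T)) (hU : Measurable U) (hV : Measurable V)
    {s : Ω → State n} (hx : Measurable fun ω => (s ω).x) (hθ : Measurable fun ω => (s ω).θ) :
    (Measurable fun ω => (step a X (empMean T (U ω)) (empMean T (V ω)) (s ω)).x) ∧
      Measurable fun ω => (step a X (empMean T (U ω)) (empMean T (V ω)) (s ω)).θ := by
  have h0 := measurable_projStep hX hc hne hT hU hx (measurable_const (a := a.γ))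
  have ht := measurable_stepsize (a := a) hX hc hne hT hU hx
  have hy := measurable_projStep hX hc hne hT hU hx ht
  have hz : Measurable fun ω => proj X ((s ω).x - stepsize a X (empMean T (U ω)) (s ω).x •
      empMean T (V ω) (projStep X (empMean T (U ω))
        (stepsize a X (empMean T (U ω)) (s ω).x) (s ω).x)) :=
    (continuous_proj hX hc hne).measurable.comp
      (hx.sub (ht.smul (measurable_empMean hT hV hy)))
  have hset0 : MeasurableSet
      {ω | projStep X (empMean T (U ω)) a.γ (s ω).x - (s ω).x = 0} :=
    (h0.sub hx) (measurableSet_singleton 0)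
  have hν : Measurable fun ω => a.ν * ((s ω).θ : ℝ) ^ (-a.τ) :=
    (Measurable.of_discrete (f := fun m : ℕ => a.ν * (m : ℝ) ^ (-a.τ))).comp hθ
  have hF := hy.sub hx
  have hF' := hz.sub hx
  have hα := @Measurable.ite _ _ _ _ _ _ _ (fun _ => Classical.propDecidable _)
    (measurableSet_lt hF'.norm (hF.norm.min hν))
    ((hF'.inner (𝕜 := ℝ) (hF'.sub hF)).div ((hF'.sub hF).norm.pow_const 2))
    (measurable_const (a := a.M + 1))
  have hset1 := measurableSet_le hα.abs (measurable_const (a := a.M))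
  unfold step
  simp only [apply_ite State.x, apply_ite State.θ]
  constructor
  · refine Measurable.ite hset0 hx (Measurable.ite hset1 ?_ hz)
    exact (hα.smul hx).add ((measurable_const.sub hα).smul hz)
  · refine Measurable.ite hset0 hθ (Measurable.ite hset1 ?_ hθ)
    exact hθ.add measurable_const

end StepMeasurability

/-! ### Independence and almost sure summability -/

section Independence

variable {Ω : Type*} [mΩ : MeasurableSpace Ω] {P : Measure Ω}

/-- Adjoining to an independent family a σ-algebra that is independent of the whole family. -/
theorem iIndep_option [IsProbabilityMeasure P] {ι : Type*} {m₀ : MeasurableSpace Ω}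
    {m : ι → MeasurableSpace Ω}
    (h : iIndep m P) (h₀ : Indep m₀ (⨆ i, m i) P) :
    iIndep (fun o : Option ι => o.elim m₀ m) P := by
  classical
  rw [iIndep_iff] at h ⊢
  intro s f hf
  have hsome := h s.eraseNone (f := fun i => f (some i)) fun i hi =>
    hf (some i) (Finset.mem_eraseNone.1 hi)
  have hmeas : MeasurableSet[⨆ i, m i] (⋂ i ∈ s.eraseNone, f (some i)) := by
    refine Finset.measurableSet_biInter _ fun i hi => ?_
    exact le_iSup m i _ (hf (some i) (Finset.mem_eraseNone.1 hi))
  by_cases hn : none ∈ s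
  · have hs : s = Finset.insertNone s.eraseNone := by
      rw [Finset.insertNone_eraseNone, Finset.insert_eq_of_mem hn]
    have h1 := (Indep_iff _ _ _).1 h₀ (f none) _ (hf none hn) hmeas
    have h2 : ⋂ i ∈ s, f i = f none ∩ ⋂ i ∈ s.eraseNone, f (some i) := by
      ext ω
      simp only [Set.mem_iInter, Set.mem_inter_iff, Finset.mem_eraseNone, Option.forall, hn,
        true_implies]
    rw [h2, h1, hsome]
    conv_rhs => rw [hs]
    rw [Finset.prod_insertNone]
  · have hs : s = s.eraseNone.map Function.Embedding.some := by
      rw [Finset.map_some_eraseNone, Finset.erase_eq_of_notMem hn]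
    have h2 : ⋂ i ∈ s, f i = ⋂ i ∈ s.eraseNone, f (some i) := by
      ext ω
      simp only [Set.mem_iInter, Finset.mem_eraseNone, Option.forall, hn,
        false_implies, true_and]
    rw [h2, hsome]
    conv_rhs => rw [hs]
    rw [Finset.prod_map]
    rfl

/-- Integrating out an independent variable. -/
theorem lintegral_le_of_indepFun [IsProbabilityMeasure P] {α β : Type*} [MeasurableSpace α]
    [MeasurableSpace β] {Y : Ω → α} {U : Ω → β} (hY : Measurable Y) (hU : Measurable U)
    (hYU : IndepFun Y U P) {Φ : α × β → ENNReal} (hΦ : Measurable Φ) {c : ENNReal}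
    (h : ∀ y, ∫⁻ ω, Φ (y, U ω) ∂P ≤ c) : ∫⁻ ω, Φ (Y ω, U ω) ∂P ≤ c := by
  have : IsProbabilityMeasure (P.map Y) := Measure.isProbabilityMeasure_map hY.aemeasurable
  have : IsProbabilityMeasure (P.map U) := Measure.isProbabilityMeasure_map hU.aemeasurable
  rw [← lintegral_map hΦ (hY.prodMk hU),
    (indepFun_iff_map_prod_eq_prod_map_map hY.aemeasurable hU.aemeasurable).1 hYU,
    lintegral_prod _ hΦ.aemeasurable]
  calc _ ≤ ∫⁻ _y, c ∂(P.map Y) := by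
        refine lintegral_mono fun y => ?_
        rw [lintegral_map (f := fun z => Φ (y, z)) (hΦ.comp measurable_prodMk_left) hU]
        exact h y
    _ = c := by simp

/-- Nonnegative random variables with summable expectations are almost surely summable. -/
theorem ae_tsum_ne_top_of_lintegral_le {f : ℕ → Ω → ENNReal} (hf : ∀ k, Measurable (f k))
    {c : ℕ → ℝ} (hc : Summable c) (hfc : ∀ k, ∫⁻ ω, f k ω ∂P ≤ ENNReal.ofReal (c k)) :
    ∀ᵐ ω ∂P, ∑' k, f k ω ≠ ⊤ := by
  have h1 : ∫⁻ ω, ∑' k, f k ω ∂P ≠ ⊤ := by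
    rw [lintegral_tsum fun k => (hf k).aemeasurable]
    exact ne_top_of_le_ne_top hc.tsum_ofReal_ne_top (ENNReal.tsum_le_tsum hfc)
  exact (ae_lt_top' (AEMeasurable.tsum fun k => (hf k).aemeasurable) h1).mono
    fun ω h => h.ne

end Independence

/-! ### Relative estimation errors -/

section Errors

variable {n N : ℕ} {Ξ : Type*} {T : Ξ → Vec n → Vec n} {X : Set (Vec n)} {H : Vec n → Vec n}

/-- The estimation error of the sample `s` at `y`. -/
noncomputable def sampleError (T : Ξ → Vec n → Vec n) (H : Vec n → Vec n) (s : Fin N → Ξ)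
    (y : Vec n) : Vec n :=
  empMean T s y - H y

/-- The estimation error at `p.1`, relative to the size of `p.1`. -/
noncomputable def relError (T : Ξ → Vec n → Vec n) (H : Vec n → Vec n)
    (p : Vec n × (Fin N → Ξ)) : ENNReal :=
  ENNReal.ofReal ((1 + ‖p.1‖)⁻¹) * ‖sampleError T H p.2 p.1‖ₑ

/-- A bound for the estimation errors at all points `P_X(y - γ ρ^m H(y))`, `y = p.1`, relative to
the size of `y`. -/
noncomputable def relTrialError (a : Params) (X : Set (Vec n)) (T : Ξ → Vec n → Vec n)
    (H : Vec n → Vec n) (p : Vec n × (Fin N → Ξ)) : ENNReal :=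
  ENNReal.ofReal ((1 + ‖p.1‖)⁻¹) * (‖sampleError T H p.2 (proj X p.1)‖ₑ
    + ∑' m : ℕ, ‖sampleError T H p.2 (projStep X H (a.γ * a.ρ ^ m) p.1)
        - sampleError T H p.2 (proj X p.1)‖ₑ)

theorem norm_sampleError_le_of_relError {y : Vec n} {s : Fin N → Ξ} :
    ‖sampleError T H s y‖ ≤ (relError T H (y, s)).toReal * (1 + ‖y‖) := by
  have hy : 0 < 1 + ‖y‖ := by positivity
  simp only [relError, ENNReal.toReal_mul, toReal_enorm]
  rw [ENNReal.toReal_ofReal (by positivity)]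
  field_simp
  rfl

/-- The error at a grid point is at most the error at `proj X y` plus one increment, and the sum
contains every increment. One random quantity thus dominates all grid points simultaneously. -/
theorem norm_sampleError_le_of_relTrialError {a : Params} {y : Vec n} {s : Fin N → Ξ}
    (h : relTrialError a X T H (y, s) ≠ ⊤) (m : ℕ) :
    ‖sampleError T H s (projStep X H (a.γ * a.ρ ^ m) y)‖
      ≤ (relTrialError a X T H (y, s)).toReal * (1 + ‖y‖) := by
  have hy : 0 < 1 + ‖y‖ := by positivity
  set z := projStep X H (a.γ * a.ρ ^ m) y
  have h1 : ENNReal.ofReal ((1 + ‖y‖)⁻¹) * ‖sampleError T H s z‖ₑ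
      ≤ relTrialError a X T H (y, s) := by
    unfold relTrialError
    gcongr
    calc ‖sampleError T H s z‖ₑ = ‖sampleError T H s (proj X y)
          + (sampleError T H s z - sampleError T H s (proj X y))‖ₑ := by
          rw [add_sub_cancel]
      _ ≤ ‖sampleError T H s (proj X y)‖ₑ
          + ‖sampleError T H s z - sampleError T H s (proj X y)‖ₑ := enorm_add_le _ _
      _ ≤ _ := by
        gcongr
        exact ENNReal.le_tsum (f := fun m : ℕ =>
          ‖sampleError T H s (projStep X H (a.γ * a.ρ ^ m) y)
            - sampleError T H s (proj X y)‖ₑ) m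
  have h2 := ENNReal.toReal_mono h h1
  rw [ENNReal.toReal_mul, toReal_enorm, ENNReal.toReal_ofReal (by positivity)] at h2
  rwa [inv_mul_le_iff₀ hy, mul_comm] at h2

variable {Ω : Type*} [MeasurableSpace Ω] [MeasurableSpace Ξ] {P : Measure Ω} {ξ : Ω → Ξ}
  {L : Ξ → ℝ} {C : ℝ}

theorem measurable_sampleError (hT : Measurable (Function.uncurry T)) (hH : Continuous H)
    {Ω' : Type*} [MeasurableSpace Ω'] {U : Ω' → Fin N → Ξ} {x : Ω' → Vec n}
    (hU : Measurable U) (hx : Measurable x) :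
    Measurable fun ω => sampleError T H (U ω) (x ω) :=
  (measurable_empMean hT hU hx).sub (hH.measurable.comp hx)

theorem measurable_relError (hT : Measurable (Function.uncurry T)) (hH : Continuous H) :
    Measurable (relError (N := N) T H) := by
  have h1 := measurable_sampleError (N := N) hT hH measurable_snd measurable_fst
  unfold relError
  fun_prop

theorem measurable_relTrialError (a : Params) (hX : IsClosed X) (hc : Convex ℝ X)
    (hne : X.Nonempty) (hT : Measurable (Function.uncurry T)) (hH : Continuous H) :
    Measurable (relTrialError (N := N) a X T H) := by
  have hp := (continuous_proj hX hc hne).measurable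
  have h1 := measurable_sampleError (N := N) hT hH measurable_snd (hp.comp measurable_fst)
  have h2 : ∀ m : ℕ, Measurable fun p : Vec n × (Fin N → Ξ) =>
      sampleError T H p.2 (projStep X H (a.γ * a.ρ ^ m) p.1) := fun m => by
    refine measurable_sampleError hT hH measurable_snd (hp.comp ?_)
    exact measurable_fst.sub ((hH.measurable.comp measurable_fst).const_smul (a.γ * a.ρ ^ m))
  unfold relTrialError
  refine Measurable.mul (by fun_prop) (h1.enorm.add (Measurable.tsum fun m => ?_))
  exact ((h2 m).sub h1).enorm

theorem SecondMoments.continuous_meanOp (hm : SecondMoments P T ξ L C) :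
    Continuous (meanOp P T ξ) :=
  (LipschitzWith.of_dist_le_mul (K := (∫ ω, L (ξ ω) ∂P).toNNReal) fun x y => by
    rw [dist_eq_norm, dist_eq_norm, Real.coe_toNNReal _ hm.integral_nonneg]
    exact hm.lipschitz_mean x y).continuous

variable [IsProbabilityMeasure P] {u : Fin N → Ω → Ξ}

theorem SecondMoments.lintegral_sampleError_le (hm : SecondMoments P T ξ L C)
    (hT : Measurable (Function.uncurry T)) (hN : 0 < N) (hum : ∀ j, Measurable (u j))
    (hu : iIndepFun u P) (hid : ∀ j, IdentDistrib (u j) ξ P P) (y : Vec n) :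
    ∫⁻ ω, ‖sampleError T (meanOp P T ξ) (fun j => u j ω) y‖ₑ ∂P
      ≤ ENNReal.ofReal (n * (C * (1 + ‖y‖)) / √(N : ℝ)) := by
  have hC := hm.const_nonneg
  exact lintegral_sampleMean_vec_le hN hum hu hid (f := fun s => T s y)
    (hT.comp measurable_prodMk_right) (hm.memLp y) (by positivity) (hm.integral_sq y)

/-- The sample-mean bound is applied to s ↦ T(s,y) - T(s,z). Proportionality to ‖y - z‖ is what
makes the sum over the trial grid converge. -/
theorem SecondMoments.lintegral_sampleError_sub_le (hm : SecondMoments P T ξ L C)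
    (hT : Measurable (Function.uncurry T)) (hN : 0 < N) (hum : ∀ j, Measurable (u j))
    (hu : iIndepFun u P) (hid : ∀ j, IdentDistrib (u j) ξ P P) (y z : Vec n) :
    ∫⁻ ω, ‖sampleError T (meanOp P T ξ) (fun j => u j ω) y
        - sampleError T (meanOp P T ξ) (fun j => u j ω) z‖ₑ ∂P
      ≤ ENNReal.ofReal (n * (C * ‖y - z‖) / √(N : ℝ)) := by
  have hC := hm.const_nonneg
  have hTy : ∀ y, Measurable fun s => T s y := fun y => hT.comp measurable_prodMk_right
  have h := lintegral_sampleMean_vec_le hN hum hu hid (f := fun s => T s y - T s z)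
    ((hTy y).sub (hTy z)) ((hm.memLp y).sub (hm.memLp z)) (by positivity)
    (hm.integral_sq_sub y z)
  refine le_of_eq_of_le (lintegral_congr fun ω => ?_) h
  rw [integral_sub ((hm.memLp y).integrable one_le_two) ((hm.memLp z).integrable one_le_two),
    Finset.sum_sub_distrib, smul_sub]
  unfold sampleError empMean meanOp
  congr 1
  abel

theorem SecondMoments.lintegral_relError_le (hm : SecondMoments P T ξ L C)
    (hT : Measurable (Function.uncurry T)) (hN : 0 < N) (hum : ∀ j, Measurable (u j))
    (hu : iIndepFun u P) (hid : ∀ j, IdentDistrib (u j) ξ P P) (y : Vec n) :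
    ∫⁻ ω, relError T (meanOp P T ξ) (y, fun j => u j ω) ∂P
      ≤ ENNReal.ofReal (n * C * (1 / √(N : ℝ))) := by
  simp only [relError]
  rw [lintegral_const_mul' _ _ ENNReal.ofReal_ne_top]
  refine (mul_le_mul_right (hm.lintegral_sampleError_le hT hN hum hu hid y) _).trans ?_
  rw [← ENNReal.ofReal_mul (by positivity)]
  refine ENNReal.ofReal_le_ofReal (le_of_eq ?_)
  field_simp

/-- Trial points lie within ρ^m(‖H 0‖ + E[L])(1+‖y‖) of P_X(y), so the increments are dominated by a
geometric series. The constant must not depend on the sample size or on `y`, hence the order of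
quantifiers. -/
theorem SecondMoments.exists_lintegral_relTrialError_le (hm : SecondMoments P T ξ L C)
    (hT : Measurable (Function.uncurry T)) {a : Params} (ha : a.Admissible)
    (hX : IsClosed X) (hc : Convex ℝ X) (hne : X.Nonempty) :
    ∃ K : ℝ, ∀ {N : ℕ} {u : Fin N → Ω → Ξ}, 0 < N → (∀ j, Measurable (u j)) →
      iIndepFun u P → (∀ j, IdentDistrib (u j) ξ P P) → ∀ y : Vec n,
      ∫⁻ ω, relTrialError a X T (meanOp P T ξ) (y, fun j => u j ω) ∂P
        ≤ ENNReal.ofReal (K * (1 / √(N : ℝ))) := by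
  set H := meanOp P T ξ
  set LH := ∫ ω, L (ξ ω) ∂P
  have hC := hm.const_nonneg
  have hLH : 0 ≤ LH := hm.integral_nonneg
  have hρ := ha.ρ_pos
  have hρ1 : 0 < 1 - a.ρ := sub_pos.2 ha.ρ_lt_one
  set A := 1 + ‖proj X 0‖ with hA
  set B := ‖H 0‖ + LH with hB
  refine ⟨n * C * A + n * C * B * (1 - a.ρ)⁻¹, fun {N u} hN hum hu hid y => ?_⟩
  have hN' : 0 < √(N : ℝ) := Real.sqrt_pos.2 (by exact_mod_cast hN)
  have hy : 0 < 1 + ‖y‖ := by positivity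
  have hp : 1 + ‖proj X y‖ ≤ A * (1 + ‖y‖) := by
    have h1 := norm_proj_sub_proj_le hX hc hne y 0
    rw [sub_zero] at h1
    have h2 : ‖proj X y‖ ≤ ‖proj X y - proj X 0‖ + ‖proj X 0‖ := by
      calc _ = ‖(proj X y - proj X 0) + proj X 0‖ := by congr 1; abel
        _ ≤ _ := norm_add_le _ _
    have h3 := mul_nonneg (norm_nonneg (proj X 0)) (norm_nonneg y)
    rw [hA]
    linarith
  have hHy : ‖H y‖ ≤ B * (1 + ‖y‖) := by
    have h1 := hm.lipschitz_mean y 0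
    rw [sub_zero] at h1
    have h2 : ‖H y‖ ≤ ‖H y - H 0‖ + ‖H 0‖ := by
      calc _ = ‖(H y - H 0) + H 0‖ := by congr 1; abel
        _ ≤ _ := norm_add_le _ _
    have h3 := mul_nonneg (norm_nonneg (H 0)) (norm_nonneg y)
    rw [hB]
    linarith
  have htrial : ∀ m : ℕ, ‖projStep X H (a.γ * a.ρ ^ m) y - proj X y‖
      ≤ a.ρ ^ m * (B * (1 + ‖y‖)) := fun m => by
    have hγ := ha.γ_pos
    have h1 := norm_proj_sub_proj_le hX hc hne (y - (a.γ * a.ρ ^ m) • H y) y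
    rw [sub_sub_cancel_left, norm_neg, norm_smul, Real.norm_of_nonneg (by positivity)] at h1
    calc _ ≤ a.γ * a.ρ ^ m * ‖H y‖ := h1
      _ ≤ 1 * a.ρ ^ m * (B * (1 + ‖y‖)) := by gcongr; exact ha.γ_le_one
      _ = _ := by ring
  have hHc : Continuous H := hm.continuous_meanOp
  have hU : Measurable fun ω j => u j ω := measurable_pi_iff.2 hum
  have hGm : ∀ z : Vec n, Measurable fun ω => sampleError T H (fun j => u j ω) z := fun z =>
    measurable_sampleError hT hHc hU measurable_const
  have hterm : ∀ m : ℕ, ∫⁻ ω, ‖sampleError T H (fun j => u j ω) (projStep X H (a.γ * a.ρ ^ m) y)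
      - sampleError T H (fun j => u j ω) (proj X y)‖ₑ ∂P
      ≤ ENNReal.ofReal (n * C * B * (1 + ‖y‖) / √(N : ℝ) * a.ρ ^ m) := fun m => by
    refine (hm.lintegral_sampleError_sub_le hT hN hum hu hid _ _).trans
      (ENNReal.ofReal_le_ofReal ?_)
    calc _ ≤ n * (C * (a.ρ ^ m * (B * (1 + ‖y‖)))) / √(N : ℝ) := by gcongr; exact htrial m
      _ = _ := by ring
  have hgeo := (hasSum_geometric_of_lt_one hρ.le ha.ρ_lt_one).mul_left
    (n * C * B * (1 + ‖y‖) / √(N : ℝ))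
  have hfirst : ∫⁻ ω, ‖sampleError T H (fun j => u j ω) (proj X y)‖ₑ ∂P
      ≤ ENNReal.ofReal (n * (C * (A * (1 + ‖y‖))) / √(N : ℝ)) := by
    refine (hm.lintegral_sampleError_le hT hN hum hu hid _).trans (ENNReal.ofReal_le_ofReal ?_)
    gcongr
  simp only [relTrialError]
  rw [lintegral_const_mul' _ _ ENNReal.ofReal_ne_top, lintegral_add_left (hGm _).enorm,
    lintegral_tsum]
  rotate_left
  · exact fun m => ((hGm _).sub (hGm _)).enorm.aemeasurable
  calc _ ≤ ENNReal.ofReal ((1 + ‖y‖)⁻¹) *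
        (ENNReal.ofReal (n * (C * (A * (1 + ‖y‖))) / √(N : ℝ))
          + ∑' m : ℕ, ENNReal.ofReal (n * C * B * (1 + ‖y‖) / √(N : ℝ) * a.ρ ^ m)) := by
        gcongr with m
        exact hterm m
    _ = ENNReal.ofReal ((1 + ‖y‖)⁻¹ * (n * (C * (A * (1 + ‖y‖))) / √(N : ℝ)
          + n * C * B * (1 + ‖y‖) / √(N : ℝ) * (1 - a.ρ)⁻¹)) := by
        rw [← ENNReal.ofReal_tsum_of_nonneg (fun m => by positivity) hgeo.summable,
          hgeo.tsum_eq, ← ENNReal.ofReal_add (by positivity) (by positivity),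
          ← ENNReal.ofReal_mul (by positivity)]
    _ = _ := by
        congr 1
        field_simp

end Errors

/-! ### Past and future of the inputs -/

section Filtration

variable {n : ℕ} {Ω Ξ : Type*} [MeasurableSpace Ξ]
  {x₀ : Ω → Vec n} {S : ℕ → ℕ} {ξs ηs : (k : ℕ) → Fin (S k) → Ω → Ξ}

/-- The index set of the starting point and of all samples. -/
abbrev InputIndex (S : ℕ → ℕ) : Type := Option (((k : ℕ) × Fin (S k)) ⊕ ((k : ℕ) × Fin (S k)))

/-- The time at which an input is used. -/
def inputTime : InputIndex S → ℕ
  | none => 0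
  | some (Sum.inl i) => 2 * i.1 + 1
  | some (Sum.inr i) => 2 * i.1 + 2

/-- The σ-algebra of a single input. -/
abbrev inputSigma (x₀ : Ω → Vec n) (ξs ηs : (k : ℕ) → Fin (S k) → Ω → Ξ) (o : InputIndex S) :
    MeasurableSpace Ω :=
  o.elim (MeasurableSpace.comap x₀ inferInstance) fun i =>
    MeasurableSpace.comap (Sum.elim (fun i : (k : ℕ) × Fin (S k) => ξs i.1 i.2)
      (fun i : (k : ℕ) × Fin (S k) => ηs i.1 i.2) i) inferInstance

/-- The σ-algebra of the inputs used up to time `c`. -/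
abbrev pastSigma (x₀ : Ω → Vec n) (ξs ηs : (k : ℕ) → Fin (S k) → Ω → Ξ) (c : ℕ) :
    MeasurableSpace Ω :=
  ⨆ o ∈ {o : InputIndex S | inputTime o ≤ c}, inputSigma x₀ ξs ηs o

/-- The σ-algebra of the inputs used after time `c`. -/
abbrev futureSigma (x₀ : Ω → Vec n) (ξs ηs : (k : ℕ) → Fin (S k) → Ω → Ξ) (c : ℕ) :
    MeasurableSpace Ω :=
  ⨆ o ∈ {o : InputIndex S | c < inputTime o}, inputSigma x₀ ξs ηs o

theorem inputSigma_le_past {c : ℕ} (o : InputIndex S) (h : inputTime o ≤ c) :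
    inputSigma x₀ ξs ηs o ≤ pastSigma x₀ ξs ηs c :=
  le_iSup₂ (f := fun o (_ : o ∈ {o : InputIndex S | inputTime o ≤ c}) =>
    inputSigma x₀ ξs ηs o) o h

theorem inputSigma_le_future {c : ℕ} (o : InputIndex S) (h : c < inputTime o) :
    inputSigma x₀ ξs ηs o ≤ futureSigma x₀ ξs ηs c :=
  le_iSup₂ (f := fun o (_ : o ∈ {o : InputIndex S | c < inputTime o}) =>
    inputSigma x₀ ξs ηs o) o h

theorem pastSigma_mono {c d : ℕ} (h : c ≤ d) :
    pastSigma x₀ ξs ηs c ≤ pastSigma x₀ ξs ηs d :=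
  iSup₂_le fun o ho => inputSigma_le_past o (le_trans ho h)

theorem measurable_ξs_past (k : ℕ) :
    Measurable[pastSigma x₀ ξs ηs (2 * k + 1)] fun ω j => ξs k j ω := by
  refine @measurable_pi_lambda _ _ _ (pastSigma x₀ ξs ηs (2 * k + 1)) _ _ fun j => ?_
  exact measurable_iff_comap_le.2
    (inputSigma_le_past (x₀ := x₀) (ξs := ξs) (ηs := ηs) (some (Sum.inl ⟨k, j⟩)) le_rfl)

theorem measurable_ηs_past (k : ℕ) :
    Measurable[pastSigma x₀ ξs ηs (2 * k + 2)] fun ω j => ηs k j ω := by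
  refine @measurable_pi_lambda _ _ _ (pastSigma x₀ ξs ηs (2 * k + 2)) _ _ fun j => ?_
  exact measurable_iff_comap_le.2
    (inputSigma_le_past (x₀ := x₀) (ξs := ξs) (ηs := ηs) (some (Sum.inr ⟨k, j⟩)) le_rfl)

theorem measurable_ξs_future (k : ℕ) :
    Measurable[futureSigma x₀ ξs ηs (2 * k)] fun ω j => ξs k j ω := by
  refine @measurable_pi_lambda _ _ _ (futureSigma x₀ ξs ηs (2 * k)) _ _ fun j => ?_
  exact measurable_iff_comap_le.2
    (inputSigma_le_future (x₀ := x₀) (ξs := ξs) (ηs := ηs) (some (Sum.inl ⟨k, j⟩))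
      (Nat.lt_succ_self _))

theorem measurable_ηs_future (k : ℕ) :
    Measurable[futureSigma x₀ ξs ηs (2 * k + 1)] fun ω j => ηs k j ω := by
  refine @measurable_pi_lambda _ _ _ (futureSigma x₀ ξs ηs (2 * k + 1)) _ _ fun j => ?_
  exact measurable_iff_comap_le.2
    (inputSigma_le_future (x₀ := x₀) (ξs := ξs) (ηs := ηs) (some (Sum.inr ⟨k, j⟩))
      (Nat.lt_succ_self _))

/-- The state at iteration `k` depends only on the inputs used before. -/
theorem measurable_state_past {X : Set (Vec n)} {a : Params} {T : Ξ → Vec n → Vec n}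
    (hX : IsClosed X) (hc : Convex ℝ X) (hne : X.Nonempty)
    (hT : Measurable (Function.uncurry T)) (k : ℕ) :
    (Measurable[pastSigma x₀ ξs ηs (2 * k)] fun ω =>
      (state a X T (fun k j => ξs k j ω) (fun k j => ηs k j ω) (x₀ ω) k).x) ∧
    Measurable[pastSigma x₀ ξs ηs (2 * k)] fun ω =>
      (state a X T (fun k j => ξs k j ω) (fun k j => ηs k j ω) (x₀ ω) k).θ := by
  induction k with
  | zero =>
    refine ⟨measurable_iff_comap_le.2
      (inputSigma_le_past (x₀ := x₀) (ξs := ξs) (ηs := ηs) none le_rfl), ?_⟩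
    exact @measurable_const _ _ _ (pastSigma x₀ ξs ηs (2 * 0)) _
  | succ k ih =>
    have hle : pastSigma x₀ ξs ηs (2 * k) ≤ pastSigma x₀ ξs ηs (2 * (k + 1)) :=
      pastSigma_mono (by omega)
    -- Measurability of a step is invoked with the past σ-algebra in place of the ambient one.
    exact @measurable_step n (S k) Ω Ξ (pastSigma x₀ ξs ηs (2 * (k + 1))) _ X a T
      (fun ω j => ξs k j ω) (fun ω j => ηs k j ω) hX hc hne hT
      ((measurable_ξs_past k).mono (pastSigma_mono (by omega)) le_rfl)
      (measurable_ηs_past k) _ (ih.1.mono hle le_rfl) (ih.2.mono hle le_rfl)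

variable [mΩ : MeasurableSpace Ω] {P : Measure Ω} {ξ : Ω → Ξ}

theorem inputSigma_le (hx₀ : Measurable x₀) (hs : IIDSamples P ξ x₀ ξs ηs) (o : InputIndex S) :
    inputSigma x₀ ξs ηs o ≤ mΩ := by
  rcases o with _ | ⟨⟨k, j⟩ | ⟨k, j⟩⟩
  · exact hx₀.comap_le
  · exact (hs.measurable_ξs k j).comap_le
  · exact (hs.measurable_ηs k j).comap_le

theorem pastSigma_le (hx₀ : Measurable x₀) (hs : IIDSamples P ξ x₀ ξs ηs) (c : ℕ) :
    pastSigma x₀ ξs ηs c ≤ mΩ :=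
  iSup₂_le fun o _ => inputSigma_le hx₀ hs o

theorem indep_past_future [IsProbabilityMeasure P] (hx₀ : Measurable x₀)
    (hs : IIDSamples P ξ x₀ ξs ηs) (c : ℕ) :
    Indep (pastSigma x₀ ξs ηs c) (futureSigma x₀ ξs ηs c) P := by
  refine indep_iSup_of_disjoint (inputSigma_le hx₀ hs) ?_ ?_
  · refine iIndep_option ((iIndepFun_iff_iIndep _ _ _).1 hs.indep) ?_
    refine indep_of_indep_of_le_right ((IndepFun_iff_Indep _ _ _).1 hs.indep_init)
      (iSup_le fun i => ?_)
    rw [← measurable_iff_comap_le]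
    have h := comap_measurable (m := inferInstance) (fun ω => ((fun k j => ξs k j ω, fun k j => ηs k j ω) :
      ((k : ℕ) → Fin (S k) → Ξ) × ((k : ℕ) → Fin (S k) → Ξ)))
    rcases i with ⟨k, j⟩ | ⟨k, j⟩
    · exact (measurable_pi_apply j).comp ((measurable_pi_apply k).comp (measurable_fst.comp h))
    · exact (measurable_pi_apply j).comp ((measurable_pi_apply k).comp (measurable_snd.comp h))
  · rw [Set.disjoint_left]
    intro o h1 h2
    exact absurd (show inputTime o ≤ c from h1) (not_le.2 (show c < inputTime o from h2))

/-- The cut c = 2k separates x_k from the first sample of iteration k; c = 2k+1 separates the trial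
point, which already uses the first sample, from the second. -/
theorem indepFun_of_past_future [IsProbabilityMeasure P] (hx₀ : Measurable x₀)
    (hs : IIDSamples P ξ x₀ ξs ηs) {α β : Type*} [MeasurableSpace α] [MeasurableSpace β]
    {Y : Ω → α} {U : Ω → β} {c : ℕ} (hY : Measurable[pastSigma x₀ ξs ηs c] Y)
    (hU : Measurable[futureSigma x₀ ξs ηs c] U) : IndepFun Y U P :=
  (IndepFun_iff_Indep _ _ _).2 (indep_of_indep_of_le_left
    (indep_of_indep_of_le_right (indep_past_future hx₀ hs c) (measurable_iff_comap_le.1 hU))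
    (measurable_iff_comap_le.1 hY))

end Filtration

/-! ### Almost sure convergence -/

section AlmostSure

variable {n : ℕ} {Ω Ξ : Type*} [MeasurableSpace Ω] [MeasurableSpace Ξ] {P : Measure Ω}
  {T : Ξ → Vec n → Vec n} {ξ : Ω → Ξ} {L : Ξ → ℝ} {C : ℝ}
  {X : Set (Vec n)} {a : Params} {S : ℕ → ℕ} {x₀ : Ω → Vec n}
  {ξs ηs : (k : ℕ) → Fin (S k) → Ω → Ξ}

theorem iIndepFun_ξs (hs : IIDSamples P ξ x₀ ξs ηs) (k : ℕ) : iIndepFun (ξs k) P :=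
  hs.indep.precomp (g := fun j => Sum.inl ⟨k, j⟩) fun i j h => by simpa using h

theorem iIndepFun_ηs (hs : IIDSamples P ξ x₀ ξs ηs) (k : ℕ) : iIndepFun (ηs k) P :=
  hs.indep.precomp (g := fun j => Sum.inr ⟨k, j⟩) fun i j h => by simpa using h

variable [IsProbabilityMeasure P]

/-- Almost surely the empirical operators are Lipschitz with a common constant. -/
theorem ae_exists_lipschitz (hm : SecondMoments P T ξ L C)
    (hS : ∀ k, 0 < S k) (hsum : Summable fun k => 1 / √(S k : ℝ))
    (hs : IIDSamples P ξ x₀ ξs ηs) :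
    ∀ᵐ ω ∂P, ∃ Λ : ℝ, 0 < Λ ∧ ∀ k x y, ‖empMean T (fun j => ξs k j ω) x
      - empMean T (fun j => ξs k j ω) y‖ ≤ Λ * ‖x - y‖ := by
  have hLξ : ∀ k j, Measurable fun ω => L (ξs k j ω) := fun k j =>
    hm.measurable_L.comp (hs.measurable_ξs k j)
  -- The deviations of the averages of L from E[L] have mean at most C/√S_k, so almost surely they
  -- are summable. Their sum bounds all of them and gives one constant for every k.
  have h1 := ae_tsum_ne_top_of_lintegral_le (P := P)
    (f := fun k ω => ‖(S k : ℝ)⁻¹ * ∑ j, L (ξs k j ω) - ∫ ω', L (ξ ω') ∂P‖ₑ)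
    (fun k => (((Finset.measurable_fun_sum _ fun j _ => hLξ k j).const_mul _).sub_const _).enorm) (hsum.mul_left C) fun k => by
      rw [mul_one_div]
      exact lintegral_sampleMean_le (hS k) (iIndepFun_ξs hs k) (hs.identDistrib_ξs k)
        hm.measurable_L hm.memLp_L hm.const_nonneg hm.integral_sq_L
  have h2 : ∀ᵐ ω ∂P, ∀ k j, ∀ x y : Vec n,
      ‖T (ξs k j ω) x - T (ξs k j ω) y‖ ≤ L (ξs k j ω) * ‖x - y‖ := by
    rw [ae_all_iff]
    intro k
    rw [ae_all_iff]
    intro j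
    have h := hm.lipschitz
    rw [← (hs.identDistrib_ξs k j).map_eq] at h
    exact ae_of_ae_map (hs.measurable_ξs k j).aemeasurable h
  filter_upwards [h1, h2] with ω h1 h2
  have hsω := ENNReal.summable_toReal h1
  simp only [toReal_enorm] at hsω
  set R := ∑' k, ‖(S k : ℝ)⁻¹ * ∑ j, L (ξs k j ω) - ∫ ω', L (ξ ω') ∂P‖
  have hR : 0 ≤ R := tsum_nonneg fun k => norm_nonneg _
  have hLH := hm.integral_nonneg
  refine ⟨(∫ ω', L (ξ ω') ∂P) + R + 1, by positivity, fun k x y => ?_⟩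
  have h3 : (S k : ℝ)⁻¹ * ∑ j, L (ξs k j ω) - ∫ ω', L (ξ ω') ∂P ≤ R :=
    (le_abs_self _).trans (hsω.le_tsum k fun i _ => norm_nonneg _)
  calc ‖empMean T (fun j => ξs k j ω) x - empMean T (fun j => ξs k j ω) y‖
      = (S k : ℝ)⁻¹ * ‖∑ j, (T (ξs k j ω) x - T (ξs k j ω) y)‖ := by
        unfold empMean
        rw [← smul_sub, norm_smul, Finset.sum_sub_distrib, norm_inv, Real.norm_natCast]
    _ ≤ (S k : ℝ)⁻¹ * ∑ j, L (ξs k j ω) * ‖x - y‖ := by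
        gcongr
        exact norm_sum_le_of_le _ fun j _ => h2 k j x y
    _ = ((S k : ℝ)⁻¹ * ∑ j, L (ξs k j ω)) * ‖x - y‖ := by rw [← Finset.sum_mul, mul_assoc]
    _ ≤ _ := by gcongr; linarith

/-- Relative errors at points independent of the samples are almost surely summable. -/
theorem ae_tsum_ne_top_of_indepFun (hsum : Summable fun k => 1 / √(S k : ℝ))
    {us : (k : ℕ) → Fin (S k) → Ω → Ξ} (hum : ∀ k j, Measurable (us k j))
    {Y : ℕ → Ω → Vec n} (hY : ∀ k, Measurable (Y k))
    (hind : ∀ k, IndepFun (Y k) (fun ω j => us k j ω) P)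
    {Φ : (k : ℕ) → Vec n × (Fin (S k) → Ξ) → ENNReal} (hΦ : ∀ k, Measurable (Φ k)) {K : ℝ}
    (hK : ∀ k y, ∫⁻ ω, Φ k (y, fun j => us k j ω) ∂P
      ≤ ENNReal.ofReal (K * (1 / √(S k : ℝ)))) :
    ∀ᵐ ω ∂P, ∑' k, Φ k (Y k ω, fun j => us k j ω) ≠ ⊤ := by
  have hU : ∀ k, Measurable fun ω j => us k j ω := fun k => measurable_pi_iff.2 (hum k)
  exact ae_tsum_ne_top_of_lintegral_le (fun k => (hΦ k).comp ((hY k).prodMk (hU k)))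
    (hsum.mul_left K) fun k => lintegral_le_of_indepFun (hY k) (hU k) (hind k) (hΦ k) (hK k)

/-- Almost sure convergence, together with a Lipschitz bound for the estimators. -/
theorem ae_convergence (hX : IsClosed X) (hc : Convex ℝ X)
    (hT : Measurable (Function.uncurry T))
    (hSOL : (SOL X (meanOp P T ξ)).Nonempty) (hp : PseudomonotoneOn (meanOp P T ξ) X)
    (hm : SecondMoments P T ξ L C) (ha : a.Admissible)
    (hS : ∀ k, 0 < S k) (hsum : Summable fun k => 1 / √(S k : ℝ))
    (hx₀ : Measurable x₀) (hs : IIDSamples P ξ x₀ ξs ηs) :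
    ∀ᵐ ω ∂P,
      (∃ xlim ∈ SOL X (meanOp P T ξ), Tendsto (iterate a X T (fun k j => ξs k j ω)
        (fun k j => ηs k j ω) (x₀ ω)) atTop (𝓝 xlim)) ∧
      Tendsto (fun k => residual X (meanOp P T ξ) a.γ (iterate a X T (fun k j => ξs k j ω)
        (fun k j => ηs k j ω) (x₀ ω) k)) atTop (𝓝 0) := by
  have hne : X.Nonempty := hSOL.mono fun x hx => hx.1
  have hHc := hm.continuous_meanOp
  set H := meanOp P T ξ
  set s : ℕ → Ω → State n := fun k ω =>
    state a X T (fun k j => ξs k j ω) (fun k j => ηs k j ω) (x₀ ω) k with hsdef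
  set y : ℕ → Ω → Vec n := fun k ω => projStep X (empMean T fun j => ξs k j ω)
    (stepsize a X (empMean T fun j => ξs k j ω) (s k ω).x) (s k ω).x
  have hxpast : ∀ k, Measurable[pastSigma x₀ ξs ηs (2 * k)] fun ω => (s k ω).x := fun k =>
    (measurable_state_past hX hc hne hT k).1
  have hypast : ∀ k, Measurable[pastSigma x₀ ξs ηs (2 * k + 1)] (y k) := fun k => by
    have h1 : Measurable[pastSigma x₀ ξs ηs (2 * k + 1)] fun ω => (s k ω).x :=
      (hxpast k).mono (pastSigma_mono (Nat.le_succ _)) le_rfl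
    exact @measurable_projStep n (S k) Ω Ξ (pastSigma x₀ ξs ηs (2 * k + 1)) _ X T
      (fun ω j => ξs k j ω) _ hX hc hne hT (measurable_ξs_past k) h1 _
      (@measurable_stepsize n (S k) Ω Ξ (pastSigma x₀ ξs ηs (2 * k + 1)) _ X a T
        (fun ω j => ξs k j ω) _ hX hc hne hT (measurable_ξs_past k) h1)
  have hxm : ∀ k, Measurable fun ω => (s k ω).x := fun k =>
    (hxpast k).mono (pastSigma_le hx₀ hs _) le_rfl
  have hym : ∀ k, Measurable (y k) := fun k => (hypast k).mono (pastSigma_le hx₀ hs _) le_rfl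
  have hxind : ∀ k, IndepFun (fun ω => (s k ω).x) (fun ω j => ξs k j ω) P := fun k =>
    indepFun_of_past_future hx₀ hs (hxpast k) (measurable_ξs_future k)
  have hyind : ∀ k, IndepFun (y k) (fun ω j => ηs k j ω) P := fun k =>
    indepFun_of_past_future hx₀ hs (hypast k) (measurable_ηs_future k)
  obtain ⟨K, hK⟩ := hm.exists_lintegral_relTrialError_le hT ha hX hc hne
  have he₁ := ae_tsum_ne_top_of_indepFun hsum hs.measurable_ξs hxm hxind
    (Φ := fun k => relError T H) (fun k => measurable_relError hT hHc)
    fun k => hm.lintegral_relError_le hT (hS k) (hs.measurable_ξs k) (iIndepFun_ξs hs k)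
      (hs.identDistrib_ξs k)
  -- These trial points are formed with `H` rather than the estimator, so they depend on x_k alone
  -- and independence from the first sample applies.
  have he₂ := ae_tsum_ne_top_of_indepFun hsum hs.measurable_ξs hxm hxind
    (Φ := fun k => relTrialError a X T H)
    (fun k => measurable_relTrialError a hX hc hne hT hHc)
    fun k => hK (hS k) (hs.measurable_ξs k) (iIndepFun_ξs hs k) (hs.identDistrib_ξs k)
  have he₃ := ae_tsum_ne_top_of_indepFun hsum hs.measurable_ηs hym hyind
    (Φ := fun k => relError T H) (fun k => measurable_relError hT hHc)
    fun k => hm.lintegral_relError_le hT (hS k) (hs.measurable_ηs k) (iIndepFun_ηs hs k)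
      (hs.identDistrib_ηs k)
  filter_upwards [he₁, he₂, he₃, ae_exists_lipschitz hm hS hsum hs]
    with ω he₁ he₂ he₃ ⟨Λ, hΛ, hh⟩
  exact tendsto_of_summable_errors hX hc hp ha hSOL hm.integral_nonneg hm.lipschitz_mean
    (s := fun k => s k ω) (h := fun k => empMean T fun j => ξs k j ω)
    (g := fun k => empMean T fun j => ηs k j ω) (fun k => rfl) hΛ hh
    (ENNReal.summable_toReal he₁) (ENNReal.summable_toReal he₂) (ENNReal.summable_toReal he₃)
    (fun k => norm_sampleError_le_of_relError)
    (fun k m => norm_sampleError_le_of_relTrialError (ENNReal.ne_top_of_tsum_ne_top he₂ k) m)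
    (fun k => norm_sampleError_le_of_relError)

end AlmostSure

end AndersonSEG

theorem mainTheorem1 {n : ℕ} {Ω Ξ : Type*} [MeasurableSpace Ω] [MeasurableSpace Ξ]
    (P : Measure Ω) [IsProbabilityMeasure P]
    (X : Set (AndersonSEG.Vec n)) (hX_closed : IsClosed X) (hX_convex : Convex ℝ X)
    (T : Ξ → AndersonSEG.Vec n → AndersonSEG.Vec n) (hT : Measurable (Function.uncurry T))
    (ξ : Ω → Ξ) (hξ : Measurable ξ)
    (hSOL : (AndersonSEG.SOL X (AndersonSEG.meanOp P T ξ)).Nonempty)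
    (hpseudo : AndersonSEG.PseudomonotoneOn (AndersonSEG.meanOp P T ξ) X)
    (hLip : AndersonSEG.LipschitzMoment P T ξ)
    (a : AndersonSEG.Params) (ha : a.Admissible)
    (S : ℕ → ℕ) (hS_pos : ∀ k, 0 < S k) (hS_sum : Summable fun k => 1 / √(S k : ℝ))
    (x₀ : Ω → AndersonSEG.Vec n) (hx₀ : Measurable x₀) (hx₀_mem : ∀ ω, x₀ ω ∈ X)
    (ξs ηs : (k : ℕ) → Fin (S k) → Ω → Ξ)
    (hsamples : AndersonSEG.IIDSamples P ξ x₀ ξs ηs)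
    (x : ℕ → Ω → AndersonSEG.Vec n)
    (hx : ∀ k ω, x k ω =
      AndersonSEG.iterate a X T (fun k j => ξs k j ω) (fun k j => ηs k j ω) (x₀ ω) k) :
    -- almost surely, every line search that is performed terminates
    (∀ᵐ ω ∂P, ∀ k,
      AndersonSEG.projStep X (AndersonSEG.empMean T fun j => ξs k j ω) a.γ (x k ω) - x k ω ≠ 0 →
      ∃ m : ℕ, AndersonSEG.Accepts a X (AndersonSEG.empMean T fun j => ξs k j ω) (x k ω)
        (a.γ * a.ρ ^ m)) ∧
    (∀ᵐ ω ∂P, ∃ xlim ∈ AndersonSEG.SOL X (AndersonSEG.meanOp P T ξ),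
      Tendsto (fun k => x k ω) atTop (𝓝 xlim)) ∧
    (∀ᵐ ω ∂P, Tendsto
      (fun k => AndersonSEG.residual X (AndersonSEG.meanOp P T ξ) a.γ (x k ω)) atTop (𝓝 0)) := by
  obtain ⟨L, C, hm⟩ := hLip.exists_secondMoments hT hξ
  have hconv := AndersonSEG.ae_convergence hX_closed hX_convex hT hSOL hpseudo hm ha hS_pos
    hS_sum hx₀ hsamples
  have hx' : ∀ ω, (fun k => x k ω) = AndersonSEG.iterate a X T (fun k j => ξs k j ω)
      (fun k j => ηs k j ω) (x₀ ω) := fun ω => funext fun k => hx k ω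
  refine ⟨?_, ?_, ?_⟩
  · filter_upwards [AndersonSEG.ae_exists_lipschitz hm hS_pos hS_sum hsamples]
      with ω ⟨Λ, _, hΛ⟩ k _
    exact AndersonSEG.exists_accepts ha (hΛ k) _
  · filter_upwards [hconv] with ω h
    rw [hx']
    exact h.1
  · filter_upwards [hconv] with ω h
    simp only [hx]
    exact h.2
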